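/- Conventions. Structures are nonempty, finite or infinite. First-order formulas are built from atomic formulas $x=y$ and $R\bar x$ by $\neg,\wedge,\vee,\forall,\exists$ ($\varphi\to\psi$ stands for $\neg\varphi\vee\psi$). The length $|\varphi|$ is the number of symbols of $\varphi$ (parentheses not counted, each variable counted as one symbol). A formula is universal if it is built from atomic and negated atomic formulas by $\wedge,\vee,\forall$. Two sentences are finitely equivalent if they have the same finite models. Let $M$ be a universal deterministic Turing machine with a one-way infinite tape (cells $0,1,2,\dots$), tape alphabet $\{0,1\}$ with $0$ as blank, finite set of states $Q$, initial state $q_0$ and halting state $q_h\ne q_0$. An instruction $q\,a\,p\,b\,d$ with $q,p\in Q$, $a,b\in\{0,1\}$, $d\in\{-1,0,1\}$ means: in state $q$ reading $a$, write $b$, move the head by $d$ and go to state $p$. $M$ halts when it reaches $q_h$; a computation that breaks off elsewhere, because no instruction applies or the head would leave the tape, does not count as halting. Universal means that for every Turing machine $N$ there is a computable coding of the inputs of $N$ by words in $\{0,1\}^*$ such that $M$ halts on the code of $x$ iff $N$ halts on $x$, and then the output of $N$ on $x$ can be computed from the final tape of $M$. The vocabulary $\tau_M$ consists of the unary symbols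 $U_{\min},U_{\max}$ and the binary symbols $<$, $S$, $C_0$, $C_0^{c}$, and $H_q$, $H_q^{c}$ for $q\in Q$. Write $C_1$ for $C_0^{c}$. For $w\in\{0,1\}^*$ put $$\chi_w:=\varphi_{0w}\wedge(\varphi_{1M}\to\neg\gamma_M),$$ where the constituents are as follows. * $\varphi_0$ is the conjunction of $\forall x\,\neg x<x$; $\forall x\forall y(x<y\vee x=y\vee y<x)$; $\forall x\forall y\forall z(x<y\wedge y<z\to x<z)$; $\forall x\forall y(U_{\min}x\to(x=y\vee x<y))$; $\forall x\forall y(U_{\max}x\to(x=y\vee y<x))$; $\forall x\forall y(Sxy\to x<y)$; $\forall x\forall y\forall z(x<y\wedge y<z\to\neg Sxz)$. * $\varphi_{1M}$ is the conjunction of $\exists x\,U_{\min}x$; $\exists x\,U_{\max}x$; $\forall x\forall y(x<y\to\exists z\,Sxz)$; $\forall x\forall t(C_0(x,t)\vee C_0^{c}(x,t))$; and $\forall x\forall t(H_q(x,t)\vee H_q^{c}(x,t))$ for $q\in Q$. * $\gamma_M:=\exists t\exists x\big(U_{\max}t\wedge H_{q_h}(x,t)\wedge\forall t'\forall y(t'<t\to\neg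 H_{q_h}(y,t'))\big)$. * $\varphi_{0w}$ is the conjunction of $\varphi_0$; $\forall x\forall t(\neg C_0(x,t)\vee\neg C_0^{c}(x,t))$; $\forall x\forall t(\neg H_q(x,t)\vee\neg H_q^{c}(x,t))$ for $q\in Q$; one sentence for each instruction of $M$; and $\varphi_w$. * The instruction $q\,a\,p\,b\,1$ contributes the sentence $$\forall x\forall x'\forall t\forall t'\forall y\Big(\big(H_q(x,t)\wedge C_a(x,t)\wedge S(x,x')\wedge S(t,t')\big)\to\big(\neg C_{1-b}(x,t')\wedge\neg H_p^{c}(x',t')\wedge(y\ne x'\to\bigwedge_{r\in Q}\neg H_r(y,t'))\wedge(y\ne x\to((C_0(y,t)\to\neg C_0^{c}(y,t'))\wedge(C_0^{c}(y,t)\to\neg C_0(y,t'))))\big)\Big).$$ For $d=-1$ the atom $S(x,x')$ is replaced by $S(x',x)$; for $d=0$ it is omitted and $x'$ is replaced by $x$. * For $w=w_1\dots w_n$ with $n\ge1$, $\varphi_w$ is the conjunction of the following three sentences, where $\alpha:=U_{\min}x_1\wedge\bigwedge_{1\le i<n}Sx_ix_{i+1}$: $\ \forall x_1\dots\forall x_n\big(\alpha\to\bigwedge_{1\le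 i\le n}\neg C_{1-w_i}(x_i,x_1)\big)$; $\ \forall x_1\dots\forall x_n\forall x\big(\alpha\wedge x_n<x\to\neg C_0^{c}(x,x_1)\big)$; $\ \forall x\forall y\big(U_{\min}x\to(\neg H_{q_0}^{c}(x,x)\wedge(y\ne x\to\bigwedge_{q\in Q}\neg H_q(y,x)))\big)$. For the empty word the first two are replaced by $\forall x_1\forall x(U_{\min}x_1\to\neg C_0^{c}(x,x_1))$. A $\tau_M$-structure $\mathcal B$ is a $<$-substructure of $\mathcal A$ if $B\subseteq A$, $R^{\mathcal B}\subseteq R^{\mathcal A}$ for all $R\in\tau_M$, and $<^{\mathcal B}\,=\,<^{\mathcal A}\cap(B\times B)$. Theorem. Let $f:\mathbb N\to\mathbb N$ be a computable function. Then there is a word $w\in\{0,1\}^*$ such that the class $\mathrm{Mod}(\chi_w)$ of all models of $\chi_w$ is closed under $<$-substructures, but $\chi_w$ is not finitely equivalent to any universal sentence of length less than $f(|\chi_w|)$. -/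

import Mathlib

universe u

namespace Gurevich



/-! ### First-order formulas over a relational vocabulary

Vocabularies and structures are those of Mathlib. The syntax has exactly the atomic formulas
`x = y` and `R x₁ … x_r`, the connectives `¬`, `∧`, `∨` and both quantifiers as primitives, so that
lengths and universal formulas can be read off directly. -/

/-- First-order formulas of the relational vocabulary `L` with free variables among
`x_0, …, x_{n-1}`. The quantifiers of `all φ` and `ex φ` bind the last variable of `φ`. -/
inductive Fml (L : FirstOrder.Language.{0, 0}) : ℕ → Type
  | eq {n : ℕ} (i j : Fin n) : Fml L n
  | rel {n r : ℕ} (R : L.Relations r) (v : Fin r → Fin n) : Fml L n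
  | not {n : ℕ} (φ : Fml L n) : Fml L n
  | and {n : ℕ} (φ ψ : Fml L n) : Fml L n
  | or {n : ℕ} (φ ψ : Fml L n) : Fml L n
  | all {n : ℕ} (φ : Fml L (n + 1)) : Fml L n
  | ex {n : ℕ} (φ : Fml L (n + 1)) : Fml L n

namespace Fml

variable {L : FirstOrder.Language.{0, 0}} {n : ℕ}

/-- `φ → ψ` abbreviates `¬φ ∨ ψ`. -/
def imp (φ ψ : Fml L n) : Fml L n := or (not φ) ψ

/-- The conjunction of a nonempty list `φ :: l`. -/
def bigAnd : Fml L n → List (Fml L n) → Fml L n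
  | φ, [] => φ
  | φ, ψ :: l => and φ (bigAnd ψ l)

/-- The sentence `∀ x_0 … ∀ x_{n-1} φ`. -/
def alls : {n : ℕ} → Fml L n → Fml L 0
  | 0, φ => φ
  | _ + 1, φ => alls (all φ)

/-- Truth of a formula in a structure under an assignment of its variables. -/
def Realize (A : Type u) [L.Structure A] : {n : ℕ} → Fml L n → (Fin n → A) → Prop
  | _, eq i j, v => v i = v j
  | _, rel R t, v => FirstOrder.Language.Structure.RelMap R (fun i => v (t i))
  | _, not φ, v => ¬ Realize A φ v
  | _, and φ ψ, v => Realize A φ v ∧ Realize A ψ v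
  | _, or φ ψ, v => Realize A φ v ∨ Realize A ψ v
  | n, all φ, v => ∀ a : A, Realize A φ (Fin.snoc v a : Fin (n + 1) → A)
  | n, ex φ, v => ∃ a : A, Realize A φ (Fin.snoc v a : Fin (n + 1) → A)

/-- The length `|φ|`: the number of symbols (parentheses not counted). A variable, a relation
symbol, `=`, a connective and a quantifier sign count as one symbol each. -/
def length : {n : ℕ} → Fml L n → ℕ
  | _, eq _ _ => 3
  | _, rel (r := r) _ _ => r + 1
  | _, not φ => length φ + 1
  | _, and φ ψ => length φ + length ψ + 1
  | _, or φ ψ => length φ + length ψ + 1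
  | _, all φ => length φ + 2
  | _, ex φ => length φ + 2

/-- Universal formulas: built from atomic and negated atomic formulas by `∧`, `∨` and `∀`. -/
inductive IsUniversal : {n : ℕ} → Fml L n → Prop
  | eq {n : ℕ} (i j : Fin n) : IsUniversal (eq i j)
  | rel {n r : ℕ} (R : L.Relations r) (v : Fin r → Fin n) : IsUniversal (rel R v)
  | not_eq {n : ℕ} (i j : Fin n) : IsUniversal (not (eq i j))
  | not_rel {n r : ℕ} (R : L.Relations r) (v : Fin r → Fin n) : IsUniversal (not (rel R v))
  | and {n : ℕ} {φ ψ : Fml L n} : IsUniversal φ → IsUniversal ψ → IsUniversal (and φ ψ)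
  | or {n : ℕ} {φ ψ : Fml L n} : IsUniversal φ → IsUniversal ψ → IsUniversal (or φ ψ)
  | all {n : ℕ} {φ : Fml L (n + 1)} : IsUniversal φ → IsUniversal (all φ)

end Fml

/-- First-order sentences. -/
abbrev Sent (L : FirstOrder.Language.{0, 0}) : Type := Fml L 0

/-- `A ⊨ φ`. -/
def Models {L : FirstOrder.Language.{0, 0}} (A : Type u) [L.Structure A] (φ : Sent L) : Prop :=
  φ.Realize A Fin.elim0

/-- `φ` and `ψ` have the same finite models. -/
def FinitelyEquivalent {L : FirstOrder.Language.{0, 0}} (φ ψ : Sent L) : Prop :=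
  ∀ (A : Type u) [Nonempty A] [Finite A] [L.Structure A], Models A φ ↔ Models A ψ

/-! ### Turing machines with a one-way infinite tape and tape alphabet `{0, 1}`

`false` is the letter `0`, which is also the blank, and `true` is the letter `1`. -/

/-- Head movements by `-1`, `0`, `1`. -/
inductive Move
  | left
  | stay
  | right

/-- A deterministic Turing machine with set of states `Fin numStates`. There is an instruction
`q a p b d` if and only if `instr q a = some (p, b, d)`. -/
structure Machine where
  numStates : ℕ
  start : Fin numStates
  halt : Fin numStates
  start_ne_halt : start ≠ halt
  instr : Fin numStates → Bool → Option (Fin numStates × Bool × Move)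

namespace Machine

/-- A configuration: state, scanned cell, and contents of the cells `0, 1, 2, …`. -/
structure Config (M : Machine) where
  state : Fin M.numStates
  head : ℕ
  tape : ℕ → Bool

variable (M : Machine)

/-- The new head position; a left move from cell `0` is impossible. -/
def moveHead : Move → ℕ → Option ℕ
  | .left, 0 => none
  | .left, i + 1 => some i
  | .stay, i => some i
  | .right, i => some (i + 1)

/-- One computation step. There is none from the halting state, and none if no instruction
is applicable or the head would leave the tape. -/
def step (c : M.Config) : Option M.Config :=
  if c.state = M.halt then none
  else
    (M.instr c.state (c.tape c.head)).bind fun pbd =>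
      (moveHead pbd.2.2 c.head).map fun i =>
        { state := pbd.1, head := i, tape := Function.update c.tape c.head pbd.2.1 }

/-- The initial configuration with input `w`, written in the first `|w|` cells. -/
def init (w : List Bool) : M.Config where
  state := M.start
  head := 0
  tape := fun i => w.getD i false

/-- The configuration after `t` steps on input `w`, if there are that many. -/
def run (w : List Bool) : ℕ → Option M.Config
  | 0 => some (M.init w)
  | t + 1 => (run w t).bind M.step

/-- On input `w` the machine reaches the halting state, in the final configuration `c`. -/
def HaltsWith (w : List Bool) (c : M.Config) : Prop :=
  c.state = M.halt ∧ ∃ t, M.run w t = some c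

/-- `M` is a universal Turing machine: it simulates every Turing machine `N` (with an arbitrary
finite alphabet `Γ` and finite set of states `Λ`). That is, the inputs `x` of `N` can be coded
effectively by inputs of `M` so that `M` halts on the code of `x` exactly if `N` halts on `x`,
and the output of `N` on `x` can then be recovered effectively from the final tape of `M`.
(Taking for `N` a machine that reads pairs consisting of a machine and an input, one sees that it
does not matter that the coding is not required to be uniform in `N`.) -/
def IsUniversal : Prop :=
  ∀ (Γ Λ : Type) [Inhabited Γ] [Finite Γ] [Primcodable Γ] [Inhabited Λ] [Finite Λ]
    (N : Turing.TM0.Machine Γ Λ),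
    ∃ (code : List Γ → List Bool) (decode : List Bool → List Γ),
      Computable code ∧ Computable decode ∧
      ∀ x : List Γ,
        ((∃ c, M.HaltsWith (code x) c) ↔ (Turing.TM0.eval N x).Dom) ∧
        ∀ (c : M.Config) (y : List Bool), M.HaltsWith (code x) c →
          (∀ i, y.getD i false = c.tape i) →
          Turing.ListBlank.mk (decode y) ∈ Turing.TM0.eval N x

end Machine

/-! ### The vocabulary `τ_M` -/

/-- The relation symbols `<`, `U_min`, `U_max`, `S`, `H_q`, `H_q^comp` (`q` a state of `M`),
`C_0` and `C_0^comp`. -/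
inductive Sym (M : Machine) : ℕ → Type
  | lt : Sym M 2
  | umin : Sym M 1
  | umax : Sym M 1
  | succ : Sym M 2
  | head (q : Fin M.numStates) : Sym M 2
  | headComp (q : Fin M.numStates) : Sym M 2
  | zero : Sym M 2
  | zeroComp : Sym M 2

/-- The vocabulary `τ_M`. -/
def tau (M : Machine) : FirstOrder.Language.{0, 0} where
  Functions := fun _ => Empty
  Relations := Sym M

/-- The `τ_M`-structure on `B ⊆ A` is a `<`-substructure of the one on `A`: every relation of
`B` is contained in that of `A`, and `<` is the restriction of that of `A`. -/
def IsLtSubstructure (M : Machine) (A : Type u) [(tau M).Structure A] (B : Set A)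
    [(tau M).Structure B] : Prop :=
  (∀ (r : ℕ) (R : (tau M).Relations r) (v : Fin r → B),
    FirstOrder.Language.Structure.RelMap R v → FirstOrder.Language.Structure.RelMap R (fun i => (v i : A))) ∧
  ∀ v : Fin 2 → B, FirstOrder.Language.Structure.RelMap (L := tau M) Sym.lt v ↔
    FirstOrder.Language.Structure.RelMap (L := tau M) Sym.lt (fun i => (v i : A))

/-- The class of all models, finite or infinite, of `φ` is closed under `<`-substructures. -/
def ClosedUnderLtSubstructures {M : Machine} (φ : Sent (tau M)) : Prop :=
  ∀ (A : Type u) [Nonempty A] [(tau M).Structure A] (B : Set A) [Nonempty B]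
    [(tau M).Structure B], IsLtSubstructure M A B → Models A φ → Models B φ

/-! ### The sentences `χ_w` -/

section Sentences

open Fml

variable (M : Machine) {n : ℕ}

/-- Atomic formulas of `τ_M`. -/
def ltF (i j : Fin n) : Fml (tau M) n := .rel (L := tau M) Sym.lt ![i, j]

def uminF (i : Fin n) : Fml (tau M) n := .rel (L := tau M) Sym.umin ![i]

def umaxF (i : Fin n) : Fml (tau M) n := .rel (L := tau M) Sym.umax ![i]

def succF (i j : Fin n) : Fml (tau M) n := .rel (L := tau M) Sym.succ ![i, j]

/-- `H_q(x, t)`: at time `t` the state is `q` and the head scans cell `x`. -/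
def headF (q : Fin M.numStates) (x t : Fin n) : Fml (tau M) n :=
  .rel (L := tau M) (Sym.head q) ![x, t]

def headCompF (q : Fin M.numStates) (x t : Fin n) : Fml (tau M) n :=
  .rel (L := tau M) (Sym.headComp q) ![x, t]

/-- `C_a(x, t)`: at time `t` the content of cell `x` is `a`; here `C_1` is `C_0^comp`. -/
def cellF : Bool → Fin n → Fin n → Fml (tau M) n
  | false, x, t => .rel (L := tau M) Sym.zero ![x, t]
  | true, x, t => .rel (L := tau M) Sym.zeroComp ![x, t]

/-- The conjunction of `F q` over all states `q` of `M`. -/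
def andStates (F : Fin M.numStates → Fml (tau M) n) : Fml (tau M) n :=
  bigAnd (F M.start) (((List.finRange M.numStates).filter (fun q => q ≠ M.start)).map F)

/-- `φ_0`: `<` is an ordering, elements of `U_min` (`U_max`) are minimal (maximal), and `S` is
contained in the successor relation. -/
def phi0 : Sent (tau M) :=
  bigAnd (alls (n := 1) (not (ltF M 0 0)))
    [ alls (n := 2) (or (ltF M 0 1) (or (eq 0 1) (ltF M 1 0))),
      alls (n := 3) (imp (and (ltF M 0 1) (ltF M 1 2)) (ltF M 0 2)),
      alls (n := 2) (imp (uminF M 0) (or (eq 0 1) (ltF M 0 1))),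
      alls (n := 2) (imp (umaxF M 0) (or (eq 0 1) (ltF M 1 0))),
      alls (n := 2) (imp (succF M 0 1) (ltF M 0 1)),
      alls (n := 3) (imp (and (ltF M 0 1) (ltF M 1 2)) (not (succF M 0 2))) ]

/-- `φ_1 = ∃x U_min x ∧ ∃x U_max x ∧ ∀x∀y (x < y → ∃z Sxz)`. -/
def phi1 : Sent (tau M) :=
  bigAnd (ex (uminF M 0))
    [ ex (umaxF M 0),
      alls (n := 2) (imp (ltF M 0 1) (ex (succF M 0 2))) ]

/-- Symbols and their complements are disjoint. -/
def disjointSymbols : Sent (tau M) :=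
  and (alls (n := 2) (or (not (cellF M false 0 1)) (not (cellF M true 0 1))))
    (andStates M fun q => alls (n := 2) (or (not (headF M q 0 1)) (not (headCompF M q 0 1))))

/-- `φ_{1M}`: `φ_1`, and symbols together with their complements exhaust all pairs. -/
def phi1M : Sent (tau M) :=
  bigAnd (phi1 M)
    [ alls (n := 2) (or (cellF M false 0 1) (cellF M true 0 1)),
      andStates M fun q => alls (n := 2) (or (headF M q 0 1) (headCompF M q 0 1)) ]

/-- What holds at time `t'` (as far as it concerns an arbitrary cell `y`) if at time `t` the head
scans `x` and the instruction writes `b`, moves the head to `x'` and changes the state to `p`. -/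
def afterStep (p : Fin M.numStates) (b : Bool) (x x' t t' y : Fin n) : Fml (tau M) n :=
  bigAnd (and (not (cellF M (!b) x t')) (not (headCompF M p x' t')))
    [ imp (not (eq y x')) (andStates M fun r => not (headF M r y t')),
      imp (not (eq y x))
        (and (imp (cellF M false y t) (not (cellF M true y t')))
          (imp (cellF M true y t) (not (cellF M false y t')))) ]

/-- The conjunct of `φ_2` for the instruction `q a p b d`. The variables are `x, x', t, t', y`
in this order, and `x, t, t', y` if the head stays (where `x' = x`). -/
def instrF (q : Fin M.numStates) (a : Bool) (p : Fin M.numStates) (b : Bool) :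
    Move → Sent (tau M)
  | .left => alls (n := 5) (imp
      (bigAnd (headF M q 0 2) [cellF M a 0 2, succF M 1 0, succF M 2 3])
      (afterStep M p b 0 1 2 3 4))
  | .stay => alls (n := 4) (imp
      (bigAnd (headF M q 0 1) [cellF M a 0 1, succF M 1 2])
      (afterStep M p b 0 0 1 2 3))
  | .right => alls (n := 5) (imp
      (bigAnd (headF M q 0 2) [cellF M a 0 2, succF M 0 1, succF M 2 3])
      (afterStep M p b 0 1 2 3 4))

/-- The conjuncts of `φ_2`, one for each instruction of `M`. -/
def phi2List : List (Sent (tau M)) :=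
  (List.finRange M.numStates).flatMap fun q => [false, true].flatMap fun a =>
    match M.instr q a with
    | none => []
    | some (p, b, d) => [instrF M q a p b d]

/-- `U_min x_0 ∧ S x_0 x_1 ∧ … ∧ S x_{k-1} x_k`, for formulas with further variables. -/
def initialChain (k : ℕ) (h : k < n) : Fml (tau M) n :=
  bigAnd (uminF M ⟨0, by omega⟩)
    ((List.finRange k).map fun i : Fin k =>
      succF M ⟨i.val, by omega⟩ ⟨i.val + 1, by omega⟩)

/-- The part of `φ_w` on the tape at time `0`: the first `|w|` cells contain `w` and the other
ones contain `0`. -/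
def initialTapeList : List Bool → List (Sent (tau M))
  | [] => [alls (n := 2) (imp (uminF M 0) (not (cellF M true 1 0)))]
  | a :: v =>
    [ alls (n := v.length + 1) (imp (initialChain M v.length (by omega))
        (bigAnd (not (cellF M (!a) 0 0))
          ((List.finRange v.length).map fun i => not (cellF M (!(v.get i)) i.succ 0)))),
      alls (n := v.length + 2) (imp
        (and (initialChain M v.length (by omega))
          (ltF M (Fin.last v.length).castSucc (Fin.last (v.length + 1))))
        (not (cellF M true (Fin.last (v.length + 1)) 0))) ]

/-- The part of `φ_w` on the head at time `0`: it scans the first cell in the initial state. -/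
def initialHead : Sent (tau M) :=
  alls (n := 2) (imp (uminF M 0)
    (and (not (headCompF M M.start 0 0))
      (imp (not (eq 1 0)) (andStates M fun q => not (headF M q 1 0)))))

/-- `φ_{0w}`. -/
def phi0w (w : List Bool) : Sent (tau M) :=
  bigAnd (phi0 M)
    (disjointSymbols M :: (phi2List M ++ initialTapeList M w ++ [initialHead M]))

/-- `γ_M`: the halting state is reached at time `max` and not before;
`∃t∃x (U_max t ∧ H_{q_h}(x,t) ∧ ∀t'∀y (t' < t → ¬H_{q_h}(y,t')))`. -/
def gammaM : Sent (tau M) :=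
  ex (ex (bigAnd (umaxF M 0)
    [ headF M M.halt 1 0,
      all (all (imp (ltF M 2 0) (not (headF M M.halt 3 2)))) ]))

/-- `χ_w = φ_{0w} ∧ (φ_{1M} → ¬γ_M)`. -/
def chi (w : List Bool) : Sent (tau M) :=
  and (phi0w M w) (imp (phi1M M) (not (gammaM M)))

end Sentences

end Gurevich

/-!
Suppose that `M` halts on `w` after exactly `h` steps.

The structure with universe `{0, …, h}` that records the computation (`RunModel`) satisfies
`φ_{0w}`, `φ_{1M}` and `γ_M`, so it violates `χ_w`. A proper induced substructure still satisfies
`φ_{0w}`, in which all symbols but `<` are negative, and it violates `φ_{1M}`: it lacks the first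
or the last element, or some element has lost its `S`-successor. Hence it is a model of `χ_w`.
A universal sentence `μ` that fails in a structure fails in an induced substructure with
at most `|μ|` elements and in all larger ones, so if `μ` is finitely equivalent to `χ_w`, then
`h ≤ |μ|` (`le_length_of_finitelyEquivalent`).

For such `w` the class of models of `χ_w` is closed under `<`-substructures
(`closedUnderLtSubstructures_chi`). Let `A` be a model of `χ_w` and `B` a `<`-substructure. Then
`B` satisfies `φ_{0w}`. Assume that it also satisfies `φ_{1M}` and `γ_M`. In an infinite model of
`φ_{0w} ∧ φ_{1M}` the first elements carry the computation of `M` on `w`, so the halting state is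
reached before the last element, against `γ_M`. Thus `B` is finite. Since it contains the least and
the greatest element of `A` and its `S`-successors are successors in `A`, it contains every
element of `A`, and then `A` satisfies `φ_{1M}` and `γ_M` as well, a contradiction.

It remains to find `w` with `h > f(|χ_w|)` (`Machine.IsUniversal.exists_haltsIn_gt`). The length of
`χ_w` is computable from `w`, and a computable number of steps of `M` can be simulated effectively.
If no such `w` existed, halting of `M` would be decidable, and by universality so would halting of
every one-tape machine with finitely many states. Composing the translations of partial
recursive functions to multi-stack machines and of these to one-tape machines yields such a
machine with undecidable halting problem (`exists_TM0_not_computablePred_halts`).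
-/

/-! ### A Turing machine with a finite description and an undecidable halting problem -/

namespace Gurevich

open Turing

/-- A machine supported by a finite set of states can be replaced by one with a finite type of
states. -/
theorem exists_finite_TM0_of_supports {Γ Λ : Type} [Inhabited Γ] [Inhabited Λ]
    (N : TM0.Machine Γ Λ) {S : Finset Λ} (hS : TM0.Supports N (S : Set Λ)) :
    ∃ (Λ₀ : Type) (_ : Inhabited Λ₀) (_ : Finite Λ₀) (N₀ : TM0.Machine Γ Λ₀),
      ∀ l, (TM0.eval N₀ l).Dom ↔ (TM0.eval N l).Dom := by
  classical
  have hd : default ∈ S := hS.1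
  let i : Inhabited {q // q ∈ S} := ⟨⟨default, hd⟩⟩
  let g : PointedMap Λ {q // q ∈ S} :=
    ⟨fun q => if h : q ∈ S then ⟨q, h⟩ else ⟨default, hd⟩, by simp [hd]; rfl⟩
  have hg : ∀ q ∈ (S : Set Λ), (g q : Λ) = q := fun q hq => by
    have hq' : q ∈ S := hq
    change ((if h : q ∈ S then (⟨q, h⟩ : {q // q ∈ S}) else ⟨default, hd⟩ : {q // q ∈ S}) : Λ) = q
    simp [hq']
  let f : PointedMap Γ Γ := ⟨id, rfl⟩
  refine ⟨{q // q ∈ S}, i, inferInstance, N.map f f g Subtype.val, fun l => ?_⟩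
  have H := TM0.Machine.map_respects N f f g Subtype.val hS (fun _ => rfl) hg
  have h := StateTransition.tr_eval_dom H (a₁ := TM0.init l) (a₂ := TM0.init l)
    ⟨hd, by rw [TM0.map_init]; congr 1; exact List.map_id l⟩
  exact h

/-- A multi-stack machine with finitely many accessible states is simulated, on the input
translated by `TM2to1.trInit`, by a one-tape machine with finitely many states. -/
theorem exists_finite_TM0_of_TM2 {K : Type} [DecidableEq K] {Γ : K → Type} {Λ σ : Type}
    [Inhabited Λ] [Inhabited σ] [Fintype σ] (M : Λ → TM2.Stmt Γ Λ σ) {S : Finset Λ}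
    (hS : TM2.Supports M S) (k : K) :
    ∃ (Λ₀ : Type) (_ : Inhabited Λ₀) (_ : Finite Λ₀) (N : TM0.Machine (TM2to1.Γ' K Γ) Λ₀),
      ∀ L, (TM0.eval N (TM2to1.trInit k L)).Dom ↔ (TM2.eval M k L).Dom := by
  obtain ⟨Λ₀, i, hf, N, hN⟩ := exists_finite_TM0_of_supports
    (TM1to0.tr (TM2to1.tr M)) (TM1to0.tr_supports _ (TM2to1.tr_supports M hS))
  refine ⟨Λ₀, i, hf, N, fun L => ?_⟩
  rw [hN, TM1to0.tr_eval, TM2to1.tr_eval_dom]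

open PartrecToTM2 in
/-- Every program for a partial recursive function is run by a one-tape machine with finitely many
states. -/
theorem exists_finite_TM0_of_code (c : ToPartrec.Code) :
    ∃ (Λ₀ : Type) (_ : Inhabited Λ₀) (_ : Finite Λ₀)
      (N : TM0.Machine (TM2to1.Γ' K' fun _ => Γ') Λ₀),
      ∀ v, (TM0.eval N (TM2to1.trInit K'.main (trList v))).Dom ↔ (c.eval v).Dom := by
  -- the initial state depends on the program
  let _ : Inhabited Λ' := ⟨trNormal c Cont'.halt⟩
  obtain ⟨Λ₀, i, hf, N, hN⟩ := exists_finite_TM0_of_TM2 (σ := Option Γ') tr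
    (tr_supports c Cont'.halt) K'.main
  refine ⟨Λ₀, i, hf, N, fun v => ?_⟩
  have h := tr_eval c v
  have hi : (TM2.init K'.main (trList v) : TM2.Cfg (fun _ : K' => Γ') Λ' (Option Γ')) =
      PartrecToTM2.init c v := by
    unfold TM2.init PartrecToTM2.init
    congr 1
    funext k; cases k <;> rfl
  rw [hN]
  change (StateTransition.eval (TM2.step tr) (TM2.init K'.main (trList v))).Dom ↔ _
  rw [hi, h]
  rfl

open PartrecToTM2 in
theorem trNat_two_pow (k : ℕ) : trNat (2 ^ k) = List.replicate k Γ'.bit0 ++ [Γ'.bit1] := by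
  induction k with
  | zero => simp [trNat, trNum, trPosNum]
  | succ k ih =>
    have h0 : ((2 ^ k : ℕ) : Num) ≠ 0 := by
      intro h
      have h' := congrArg (fun n : Num => (n : ℕ)) h
      rw [Num.to_of_nat] at h'
      exact (pow_pos two_pos k).ne' h'
    have h2 : ((2 ^ (k + 1) : ℕ) : Num) = Num.bit0 ((2 ^ k : ℕ) : Num) := by
      apply Num.to_nat_inj.1
      rw [Num.cast_bit0]
      simp only [Num.to_of_nat]
      ring
    unfold trNat at ih ⊢
    rw [h2, List.replicate_succ, List.cons_append, ← ih]
    cases h : ((2 ^ k : ℕ) : Num) with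
    | zero => exact absurd h h0
    | pos p => rfl

theorem primrec_replicate {α : Type*} [Primcodable α] (a : α) :
    Primrec fun n => List.replicate n a := by
  refine (Primrec.list_map Primrec.list_range (Primrec₂.const a)).of_eq fun n => ?_
  simp

instance : Fintype PartrecToTM2.K' :=
  ⟨{.main, .rev, .aux, .stack}, by rintro ⟨⟩ <;> simp⟩

/-- The machine computes a partial function whose domain is undecidable already on powers of `2`.
As `trNat (2 ^ k)` is a very simple word, the corresponding inputs of the machine are seen at once
to be computable from `k`. -/
theorem exists_TM0_not_computablePred_halts :
    ∃ (Γ Λ : Type) (_ : Inhabited Γ) (_ : Finite Γ) (_ : Primcodable Γ) (_ : Inhabited Λ)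
      (_ : Finite Λ) (N : TM0.Machine Γ Λ),
      ¬ ComputablePred fun x : List Γ => (TM0.eval N x).Dom := by
  classical
  let P : Nat.Partrec.Code →. ℕ := fun c => c.eval 0
  have hP : Partrec P := Nat.Partrec.Code.eval_part.comp Computable.id (Computable.const 0)
  -- `Q` is `P` on codes of programs, and `R (2 ^ k) = Q k`
  let Q : ℕ →. ℕ := fun n => Part.bind (Encodable.decode (α := Nat.Partrec.Code) n)
    fun a => (P a).map Encodable.encode
  have hQ : Partrec Q := Partrec.nat_iff.2 hP
  let R : ℕ →. ℕ := fun m => (Nat.rfind fun k => Part.some (decide (2 ^ k = m))).bind Q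
  have hR : Partrec R := by
    refine Partrec.bind (Partrec.rfind ?_) (hQ.comp Computable.snd).to₂
    have : PrimrecRel fun (m k : ℕ) => 2 ^ k = m :=
      Primrec.eq.comp ((Primrec₂.unpaired'.1 Nat.Primrec.pow).comp (Primrec.const 2) Primrec.snd)
        Primrec.fst
    exact this.decide.to_comp.partrec
  have hRQ : ∀ k, R (2 ^ k) = Q k := fun k => by
    have : (Nat.rfind fun j => Part.some (decide (2 ^ j = 2 ^ k))) = Part.some k := by
      refine Part.eq_some_iff.2 (Nat.mem_rfind.2 ⟨by simp, fun {m} hm => ?_⟩)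
      simp [hm.ne]
    change (Nat.rfind fun j => Part.some (decide (2 ^ j = 2 ^ k))).bind Q = Q k
    rw [this, Part.bind_some]
  obtain ⟨c, hc⟩ := ToPartrec.Code.exists_code (Nat.Partrec'.part_iff₁.2 hR)
  obtain ⟨Λ₀, i, hf, N, hN⟩ := exists_finite_TM0_of_code c
  let Γ₀ : Type := TM2to1.Γ' PartrecToTM2.K' fun _ => PartrecToTM2.Γ'
  let _ : Primcodable Γ₀ := Primcodable.ofEquiv _ (Fintype.equivFin Γ₀)
  refine ⟨Γ₀, Λ₀, inferInstance, inferInstance, inferInstance, i, hf, N, fun hcomp => ?_⟩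
  let X : PartrecToTM2.Γ' → PartrecToTM2.K' → Option PartrecToTM2.Γ' := fun a =>
    Function.update (fun _ => none) .main (some a)
  let input : ℕ → List Γ₀ := fun k =>
    (true, X .cons) :: (false, X .bit1) :: List.replicate k (false, X .bit0)
  have hin : Computable input :=
    (Primrec.list_cons.comp (Primrec.const _)
      (Primrec.list_cons.comp (Primrec.const _) (primrec_replicate _))).to_comp
  have hin' : ∀ k, TM2to1.trInit PartrecToTM2.K'.main (PartrecToTM2.trList [2 ^ k]) = input k := by
    intro k
    have hr : (PartrecToTM2.trList [2 ^ k]).reverse = .cons :: .bit1 :: List.replicate k .bit0 := by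
      simp [PartrecToTM2.trList, trNat_two_pow]
    let F : PartrecToTM2.Γ' → Γ₀ := fun a => (false, X a)
    change (true, (List.map F (PartrecToTM2.trList [2 ^ k]).reverse).headI.2) ::
      (List.map F (PartrecToTM2.trList [2 ^ k]).reverse).tail = _
    rw [hr]
    simp only [List.map_cons, List.headI_cons, List.tail_cons, List.map_replicate]
    rfl
  refine ComputablePred.halting_problem 0 ?_
  have := ComputablePred.computable_of_manyOneReducible
    (p := fun c : Nat.Partrec.Code => (c.eval 0).Dom) ⟨fun c => input (Encodable.encode c),
      hin.comp Computable.encode, fun d => ?_⟩ hcomp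
  · exact this
  · change (d.eval 0).Dom ↔ (TM0.eval N (input (Encodable.encode d))).Dom
    rw [← hin', hN]
    have h1 := hc ⟨[2 ^ Encodable.encode d], rfl⟩
    change c.eval [2 ^ Encodable.encode d] = _ at h1
    rw [h1]
    change _ ↔ (R (2 ^ Encodable.encode d)).Dom
    rw [hRQ]
    simp [Q, P]

end Gurevich

/-! ### Computable simulation of a machine -/

namespace Gurevich

namespace Machine

/-- Head movements and elements of `Fin 3` correspond to each other; this makes `Move` a type on
which computability makes sense. -/
def moveEquiv : Move ≃ Fin 3 where
  toFun | .left => 0 | .stay => 1 | .right => 2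
  invFun | 0 => .left | 1 => .stay | 2 => .right
  left_inv d := by cases d <;> rfl
  right_inv i := by fin_cases i <;> rfl

instance : Finite Move := Finite.of_equiv _ moveEquiv.symm

instance : Primcodable Move := Primcodable.ofEquiv _ moveEquiv

theorem primrec_moveHead : Primrec₂ moveHead := by
  classical
  have hc : ∀ d : Move, PrimrecPred fun p : Move × ℕ => p.1 = d := fun d =>
    Primrec.eq.comp Primrec.fst (Primrec.const d)
  have h := Primrec.ite (hc .left)
    (Primrec.nat_casesOn Primrec.snd (Primrec.const none)
      (Primrec.option_some.comp Primrec.snd).to₂)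
    (Primrec.ite (hc .stay) (Primrec.option_some.comp Primrec.snd)
      (Primrec.option_some.comp (Primrec.succ.comp Primrec.snd)))
  refine h.of_eq fun p => ?_
  obtain ⟨d, i⟩ := p
  cases d
  · cases i <;> simp [moveHead]
  · simp [moveHead]
  · simp [moveHead]

variable (M : Machine)

/-- A finite description of a configuration: state, head position, and a word that is followed by
blanks on the tape. -/
abbrev FinConfig : Type := Fin M.numStates × ℕ × List Bool

variable {M} in
/-- The configuration with a given finite description. -/
def FinConfig.toConfig (s : M.FinConfig) : M.Config := ⟨s.1, s.2.1, fun i => s.2.2.getD i false⟩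

/-- Replaces letter `i` of the word `l`, which is first extended by sufficiently many blanks. -/
def writeAt (l : List Bool) (i : ℕ) (b : Bool) : List Bool :=
  (l ++ List.replicate (i + 1) false).set i b

theorem getD_writeAt (l : List Bool) (i : ℕ) (b : Bool) :
    (fun j => (writeAt l i b).getD j false) =
      Function.update (fun j => l.getD j false) i b := by
  funext j
  rcases eq_or_ne j i with rfl | h
  · have h : j < l.length + (j + 1) := by omega
    simp [writeAt, List.getD_eq_getElem?_getD, h]
  · simp only [writeAt, List.getD_eq_getElem?_getD, Function.update_of_ne h,
      List.getElem?_set_ne h.symm, List.getElem?_append, List.getElem?_replicate]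
    split_ifs with h1 h2
    · rfl
    · simp [List.getElem?_eq_none (not_lt.1 h1)]
    · simp [List.getElem?_eq_none (not_lt.1 h1)]

/-- A computation step on finite descriptions, except that a halting configuration is kept. -/
def finStep (s : M.FinConfig) : Option M.FinConfig :=
  if s.1 = M.halt then some s
  else
    (M.instr s.1 (s.2.2.getD s.2.1 false)).bind fun pbd =>
      (moveHead pbd.2.2 s.2.1).map fun i => (pbd.1, i, writeAt s.2.2 s.2.1 pbd.2.1)

theorem step_toConfig (s : M.FinConfig) (h : s.1 ≠ M.halt) :
    M.step s.toConfig = (M.finStep s).map FinConfig.toConfig := by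
  unfold step finStep
  rw [if_neg h, if_neg (show s.toConfig.state ≠ M.halt from h), Option.map_bind]
  change (M.instr s.1 (s.2.2.getD s.2.1 false)).bind _ = _
  congr 1
  funext pbd
  change (moveHead pbd.2.2 s.2.1).map _ = ((moveHead pbd.2.2 s.2.1).map _).map _
  rw [Option.map_map]
  congr 1
  funext i
  simp only [FinConfig.toConfig, Function.comp_apply, getD_writeAt]

theorem primrec_writeAt :
    Primrec fun p : List Bool × ℕ × Bool => writeAt p.1 p.2.1 p.2.2 :=
  Primrec.list_set.comp
    (Primrec.list_append.comp Primrec.fst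
      ((primrec_replicate false).comp (Primrec.succ.comp (Primrec.fst.comp Primrec.snd))))
    Primrec.snd

theorem primrec_finStep : Primrec M.finStep := by
  have hi : Primrec fun p : Fin M.numStates × Bool => M.instr p.1 p.2 := Primrec.dom_finite _
  have hr : Primrec fun s : M.FinConfig => s.2.2.getD s.2.1 false :=
    (Primrec.list_getD false).comp (Primrec.snd.comp Primrec.snd) (Primrec.fst.comp Primrec.snd)
  have hs : Primrec fun q : (M.FinConfig × (Fin M.numStates × Bool × Move)) × ℕ =>
      ((q.1.2.1, q.2, writeAt q.1.1.2.2 q.1.1.2.1 q.1.2.2.1) : M.FinConfig) := by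
    have h1 : Primrec fun q : (M.FinConfig × (Fin M.numStates × Bool × Move)) × ℕ => q.1.1.2 :=
      Primrec.snd.comp (Primrec.fst.comp Primrec.fst)
    have h2 : Primrec fun q : (M.FinConfig × (Fin M.numStates × Bool × Move)) × ℕ => q.1.2 :=
      Primrec.snd.comp Primrec.fst
    exact (Primrec.fst.comp h2).pair (Primrec.snd.pair
      (primrec_writeAt.comp ((Primrec.snd.comp h1).pair ((Primrec.fst.comp h1).pair
        (Primrec.fst.comp (Primrec.snd.comp h2))))))
  refine Primrec.ite (Primrec.eq.comp Primrec.fst (Primrec.const _)) Primrec.option_some ?_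
  refine Primrec.option_bind (hi.comp (Primrec.fst.pair hr)) ?_
  refine Primrec.option_map (primrec_moveHead.comp ?_ ?_) hs.to₂
  · exact Primrec.snd.comp (Primrec.snd.comp Primrec.snd)
  · exact Primrec.fst.comp (Primrec.snd.comp Primrec.fst)

/-- The computation on input `w`, on finite descriptions, stationary once it has halted. -/
def finRun (w : List Bool) (t : ℕ) : Option M.FinConfig :=
  (fun o : Option M.FinConfig => o.bind M.finStep)^[t] (some (M.start, 0, w))

/-- On input `w` the machine halts after exactly `t` steps. -/
def HaltsIn (w : List Bool) (t : ℕ) : Prop :=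
  ∃ c, M.run w t = some c ∧ c.state = M.halt

/-- Up to the first halting configuration `finRun` describes `run`; from then on it is halted. -/
theorem finRun_eq_or_halted (w : List Bool) (T : ℕ) :
    ((¬ ∃ t < T, M.HaltsIn w t) ∧ M.run w T = (M.finRun w T).map FinConfig.toConfig) ∨
      (∃ t < T, M.HaltsIn w t) ∧ ∃ s, M.finRun w T = some s ∧ s.1 = M.halt := by
  induction T with
  | zero => exact .inl ⟨by simp, rfl⟩
  | succ T ih =>
    have hs : M.finRun w (T + 1) = (M.finRun w T).bind M.finStep :=
      Function.iterate_succ_apply' _ _ _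
    rcases ih with ⟨hn, he⟩ | ⟨⟨t, ht, hh⟩, s, hs', hq⟩
    · cases hr : M.finRun w T with
      | none =>
        refine .inl ⟨?_, ?_⟩
        · rintro ⟨t, ht, hh⟩
          rcases Nat.lt_succ_iff_lt_or_eq.1 ht with h | rfl
          · exact hn ⟨t, h, hh⟩
          · obtain ⟨c, hc, -⟩ := hh
            rw [he, hr] at hc
            cases hc
        · rw [run, he, hs, hr]
          rfl
      | some s =>
        rw [hr] at he
        by_cases hq : s.1 = M.halt
        · refine .inr ⟨⟨T, T.lt_succ_self, _, he, hq⟩, s, ?_, hq⟩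
          rw [hs, hr, Option.bind_some, finStep, if_pos hq]
        · refine .inl ⟨?_, ?_⟩
          · rintro ⟨t, ht, hh⟩
            rcases Nat.lt_succ_iff_lt_or_eq.1 ht with h | rfl
            · exact hn ⟨t, h, hh⟩
            · obtain ⟨c, hc, hc'⟩ := hh
              rw [he] at hc
              cases hc
              exact hq hc'
          · rw [run, he, hs, hr]
            exact M.step_toConfig s hq
    · refine .inr ⟨⟨t, ht.trans T.lt_succ_self, hh⟩, s, ?_, hq⟩
      rw [hs, hs', Option.bind_some, finStep, if_pos hq]

theorem exists_haltsIn_le_iff (w : List Bool) (T : ℕ) :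
    (∃ t ≤ T, M.HaltsIn w t) ↔ (M.finRun w T).map Prod.fst = some M.halt := by
  rcases M.finRun_eq_or_halted w T with ⟨hn, he⟩ | ⟨⟨t, ht, hh⟩, s, hs, hq⟩
  · have : (∃ t ≤ T, M.HaltsIn w t) ↔ M.HaltsIn w T := by
      refine ⟨?_, fun h => ⟨T, le_rfl, h⟩⟩
      rintro ⟨t, ht, hh⟩
      rcases ht.lt_or_eq with h | rfl
      · exact absurd ⟨t, h, hh⟩ hn
      · exact hh
    rw [this, HaltsIn, he]
    cases M.finRun w T <;> simp [FinConfig.toConfig]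
  · simp only [hs, Option.map_some, hq, iff_true]
    exact ⟨t, ht.le, hh⟩

/-- Halting within a computable number of steps is decidable. -/
theorem computablePred_exists_haltsIn_le {g : List Bool → ℕ} (hg : Computable g) :
    ComputablePred fun w => ∃ t ≤ g w, M.HaltsIn w t := by
  have hrun : Primrec₂ M.finRun :=
    Primrec.nat_iterate Primrec.snd
      (Primrec.option_some.comp ((Primrec.const M.start).pair
        ((Primrec.const 0).pair Primrec.fst)))
      (Primrec.option_bind Primrec.snd (M.primrec_finStep.comp Primrec.snd).to₂).to₂
  have h : PrimrecPred fun p : List Bool × ℕ =>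
      (M.finRun p.1 p.2).map Prod.fst = some M.halt :=
    Primrec.eq.comp (Primrec.option_map hrun (Primrec.fst.comp Primrec.snd).to₂)
      (Primrec.const _)
  obtain ⟨d, hd⟩ := h
  refine ⟨fun w => Classical.dec _, ?_⟩
  refine (hd.to_comp.comp (Computable.id.pair hg)).of_eq fun w => ?_
  simp only [M.exists_haltsIn_le_iff]
  exact decide_eq_decide.2 Iff.rfl

theorem exists_haltsWith_iff (w : List Bool) :
    (∃ c, M.HaltsWith w c) ↔ ∃ t, M.HaltsIn w t :=
  ⟨fun ⟨c, hc, t, ht⟩ => ⟨t, c, ht, hc⟩, fun ⟨t, c, ht, hc⟩ => ⟨c, hc, t, ht⟩⟩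

/-- The halting time of a universal machine is not bounded by any computable function of the
input. -/
theorem IsUniversal.exists_haltsIn_gt {M : Machine} (hM : M.IsUniversal) {g : List Bool → ℕ}
    (hg : Computable g) : ∃ w h, M.HaltsIn w h ∧ g w < h := by
  by_contra! hcon
  obtain ⟨Γ, Λ, _, _, _, _, _, N, hN⟩ := exists_TM0_not_computablePred_halts
  obtain ⟨code, decode, hcode, -, h⟩ := hM Γ Λ N
  have hx : ∀ x, (Turing.TM0.eval N x).Dom ↔ ∃ t ≤ g (code x), M.HaltsIn (code x) t := by
    intro x
    rw [← (h x).1, exists_haltsWith_iff]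
    exact ⟨fun ⟨t, ht⟩ => ⟨t, hcon _ _ ht, ht⟩, fun ⟨t, _, ht⟩ => ⟨t, ht⟩⟩
  exact hN (ComputablePred.computable_of_manyOneReducible ⟨code, hcode, hx⟩
    (M.computablePred_exists_haltsIn_le hg))

end Machine

/-! ### The length of `χ_w` -/

theorem Fml.length_bigAnd {L : FirstOrder.Language.{0, 0}} {n : ℕ} (φ : Fml L n)
    (l : List (Fml L n)) :
    (Fml.bigAnd φ l).length = φ.length + (l.map fun ψ => ψ.length + 1).sum := by
  induction l generalizing φ with
  | nil => rfl
  | cons ψ l ih => simp [Fml.bigAnd, Fml.length, ih]; omega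

theorem Fml.length_alls {L : FirstOrder.Language.{0, 0}} {n : ℕ} (φ : Fml L n) :
    (Fml.alls φ).length = φ.length + 2 * n := by
  induction n with
  | zero => rfl
  | succ n ih => simp [Fml.alls, Fml.length, ih]; omega

theorem length_initialChain (M : Machine) {n : ℕ} (k : ℕ) (h : k < n) :
    (initialChain M k h).length = 2 + 4 * k := by
  simp [initialChain, Fml.length_bigAnd, uminF, succF, Fml.length, Function.comp_def]
  omega

theorem length_cellF (M : Machine) {n : ℕ} (b : Bool) (x t : Fin n) :
    (cellF M b x t).length = 3 := by
  cases b <;> rfl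

/-- The word `w` enters the length of `χ_w` through its own length only. -/
theorem computable_length_chi (M : Machine) : Computable fun w => (chi M w).length := by
  obtain ⟨a, b, c, h⟩ : ∃ a b c, ∀ w, (chi M w).length =
      Nat.casesOn (motive := fun _ => ℕ) w.length a (fun k => b + c * k) := by
    let K := (chi M []).length
    refine ⟨K, K + 15, 17, fun w => ?_⟩
    cases w with
    | nil => rfl
    | cons x v =>
      simp [K, chi, Fml.length, phi0w, Fml.length_bigAnd, initialTapeList, Fml.length_alls,
        Fml.imp, length_initialChain, length_cellF, ltF, uminF, Function.comp_def]
      ring_nf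
  have : Primrec fun w : List Bool =>
      (Nat.casesOn (motive := fun _ => ℕ) w.length a (fun k => b + c * k)) :=
    Primrec.nat_casesOn Primrec.list_length (Primrec.const a)
      (Primrec.nat_add.comp (Primrec.const b)
        (Primrec.nat_mul.comp (Primrec.const c) Primrec.snd)).to₂
  exact this.to_comp.of_eq fun w => (h w).symm

end Gurevich

/-! ### Truth of the auxiliary formulas -/

namespace Gurevich

open Fml

section Realize

variable {L : FirstOrder.Language.{0, 0}} {A : Type u} [L.Structure A] {n : ℕ}

theorem realize_imp (φ ψ : Fml L n) (v : Fin n → A) :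
    (imp φ ψ).Realize A v ↔ (φ.Realize A v → ψ.Realize A v) :=
  imp_iff_not_or.symm

theorem realize_bigAnd (φ : Fml L n) (l : List (Fml L n)) (v : Fin n → A) :
    (bigAnd φ l).Realize A v ↔ φ.Realize A v ∧ ∀ ψ ∈ l, ψ.Realize A v := by
  induction l generalizing φ with
  | nil => simp [bigAnd]
  | cons ψ l ih => simp [bigAnd, Realize, ih]

theorem models_alls (φ : Fml L n) : Models A (alls φ) ↔ ∀ v : Fin n → A, φ.Realize A v := by
  induction n with
  | zero => exact ⟨fun h v => (Subsingleton.elim v Fin.elim0) ▸ h, fun h => h _⟩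
  | succ n ih =>
    rw [alls, ih]
    refine ⟨fun h v => ?_, fun h v a => h _⟩
    have := h (Fin.init v) (v (Fin.last n))
    rwa [Fin.snoc_init_self] at this

theorem models_bigAnd (φ : Sent L) (l : List (Sent L)) :
    Models A (bigAnd φ l) ↔ Models A φ ∧ ∀ ψ ∈ l, Models A ψ :=
  realize_bigAnd _ _ _

end Realize

theorem snoc_elim0 {A : Type u} (a : A) :
    (Fin.snoc (Fin.elim0 : Fin 0 → A) a : Fin 1 → A) = ![a] := by
  funext i; fin_cases i; rfl

theorem snoc_vec_one {A : Type u} (a b : A) : (Fin.snoc ![a] b : Fin 2 → A) = ![a, b] := by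
  funext i; fin_cases i <;> rfl

theorem snoc_vec_two {A : Type u} (a b c : A) :
    (Fin.snoc ![a, b] c : Fin 3 → A) = ![a, b, c] := by
  funext i; fin_cases i <;> rfl

theorem snoc_vec_three {A : Type u} (a b c d : A) :
    (Fin.snoc ![a, b, c] d : Fin 4 → A) = ![a, b, c, d] := by
  funext i; fin_cases i <;> rfl

theorem forall_vec_one {A : Type u} {P : (Fin 1 → A) → Prop} : (∀ v, P v) ↔ ∀ a, P ![a] :=
  ⟨fun h _ => h _, fun h v => by convert h (v 0) using 1; funext i; fin_cases i; rfl⟩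

theorem forall_vec_two {A : Type u} {P : (Fin 2 → A) → Prop} :
    (∀ v, P v) ↔ ∀ a b, P ![a, b] :=
  ⟨fun h _ _ => h _, fun h v => by
    convert h (v 0) (v 1) using 1; funext i; fin_cases i <;> rfl⟩

theorem forall_vec_three {A : Type u} {P : (Fin 3 → A) → Prop} :
    (∀ v, P v) ↔ ∀ a b c, P ![a, b, c] :=
  ⟨fun h _ _ _ => h _, fun h v => by
    convert h (v 0) (v 1) (v 2) using 1; funext i; fin_cases i <;> rfl⟩

theorem forall_vec_four {A : Type u} {P : (Fin 4 → A) → Prop} :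
    (∀ v, P v) ↔ ∀ a b c d, P ![a, b, c, d] :=
  ⟨fun h _ _ _ _ => h _, fun h v => by
    convert h (v 0) (v 1) (v 2) (v 3) using 1; funext i; fin_cases i <;> rfl⟩

theorem forall_vec_five {A : Type u} {P : (Fin 5 → A) → Prop} :
    (∀ v, P v) ↔ ∀ a b c d e, P ![a, b, c, d, e] :=
  ⟨fun h _ _ _ _ _ => h _, fun h v => by
    convert h (v 0) (v 1) (v 2) (v 3) (v 4) using 1; funext i; fin_cases i <;> rfl⟩

section Tau

open FirstOrder.Language.Structure

variable (M : Machine) {A : Type u} [(tau M).Structure A] {n : ℕ}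

/-- The interpretation of `<` in a `τ_M`-structure. -/
def Lt (x y : A) : Prop := RelMap (L := tau M) Sym.lt ![x, y]

/-- The interpretation of `U_min`. -/
def UMin (x : A) : Prop := RelMap (L := tau M) Sym.umin ![x]

/-- The interpretation of `U_max`. -/
def UMax (x : A) : Prop := RelMap (L := tau M) Sym.umax ![x]

/-- The interpretation of `S`. -/
def Succ (x y : A) : Prop := RelMap (L := tau M) Sym.succ ![x, y]

/-- The interpretation of `H_q`. -/
def Head (q : Fin M.numStates) (x t : A) : Prop := RelMap (L := tau M) (Sym.head q) ![x, t]

/-- The interpretation of `H_q^c`. -/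
def HeadComp (q : Fin M.numStates) (x t : A) : Prop :=
  RelMap (L := tau M) (Sym.headComp q) ![x, t]

/-- The interpretations of `C_0` and of `C_1 = C_0^c`. -/
def Cell : Bool → A → A → Prop
  | false, x, t => RelMap (L := tau M) Sym.zero ![x, t]
  | true, x, t => RelMap (L := tau M) Sym.zeroComp ![x, t]

variable {M}

theorem comp_vec_one (v : Fin n → A) (i : Fin n) : (fun k => v (![i] k)) = ![v i] := by
  funext k; fin_cases k; rfl

theorem comp_vec_two (v : Fin n → A) (i j : Fin n) :
    (fun k => v (![i, j] k)) = ![v i, v j] := by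
  funext k; fin_cases k <;> rfl

variable (v : Fin n → A) (i j : Fin n)

theorem realize_ltF : (ltF M i j).Realize A v ↔ Lt M (v i) (v j) := by
  rw [Lt, ← comp_vec_two]; rfl

theorem realize_uminF : (uminF M i).Realize A v ↔ UMin M (v i) := by
  rw [UMin, ← comp_vec_one]; rfl

theorem realize_umaxF : (umaxF M i).Realize A v ↔ UMax M (v i) := by
  rw [UMax, ← comp_vec_one]; rfl

theorem realize_succF : (succF M i j).Realize A v ↔ Succ M (v i) (v j) := by
  rw [Succ, ← comp_vec_two]; rfl

theorem realize_headF (q : Fin M.numStates) :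
    (headF M q i j).Realize A v ↔ Head M q (v i) (v j) := by
  rw [Head, ← comp_vec_two]; rfl

theorem realize_headCompF (q : Fin M.numStates) :
    (headCompF M q i j).Realize A v ↔ HeadComp M q (v i) (v j) := by
  rw [HeadComp, ← comp_vec_two]; rfl

theorem realize_cellF (b : Bool) : (cellF M b i j).Realize A v ↔ Cell M b (v i) (v j) := by
  cases b <;> rw [Cell, ← comp_vec_two] <;> rfl

theorem mem_andStates_list (q : Fin M.numStates) :
    q = M.start ∨ q ∈ (List.finRange M.numStates).filter (fun q => q ≠ M.start) := by
  by_cases h : q = M.start <;> simp [h]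

theorem realize_andStates (F : Fin M.numStates → Fml (tau M) n) :
    (andStates M F).Realize A v ↔ ∀ q, (F q).Realize A v := by
  rw [andStates, realize_bigAnd]
  refine ⟨fun h q => ?_, fun h => ⟨h _, fun ψ hψ => ?_⟩⟩
  · rcases mem_andStates_list q with rfl | hq
    · exact h.1
    · exact h.2 _ (List.mem_map_of_mem hq)
  · obtain ⟨q, -, rfl⟩ := List.mem_map.1 hψ
    exact h q

theorem models_phi0 : Models A (phi0 M) ↔
    (∀ x : A, ¬ Lt M x x) ∧ (∀ x y : A, Lt M x y ∨ x = y ∨ Lt M y x) ∧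
    (∀ x y z : A, Lt M x y ∧ Lt M y z → Lt M x z) ∧
    (∀ x y : A, UMin M x → x = y ∨ Lt M x y) ∧ (∀ x y : A, UMax M x → x = y ∨ Lt M y x) ∧
    (∀ x y : A, Succ M x y → Lt M x y) ∧
    ∀ x y z : A, Lt M x y ∧ Lt M y z → ¬ Succ M x z := by
  simp only [phi0, models_bigAnd, List.forall_mem_cons, models_alls, forall_vec_one,
    forall_vec_two, forall_vec_three, Realize, realize_imp, realize_ltF, realize_uminF,
    realize_umaxF, realize_succF]
  simp

theorem models_disjointSymbols : Models A (disjointSymbols M) ↔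
    (∀ x t : A, ¬ Cell M false x t ∨ ¬ Cell M true x t) ∧
    ∀ (q : Fin M.numStates) (x t : A), ¬ Head M q x t ∨ ¬ HeadComp M q x t := by
  have h : Models A (disjointSymbols M) ↔
      Models A (alls (n := 2) (or (not (cellF M false 0 1)) (not (cellF M true 0 1)))) ∧
      ∀ q, Models A (alls (n := 2) (or (not (headF M q 0 1)) (not (headCompF M q 0 1)))) :=
    and_congr_right fun _ => realize_andStates _ _
  simp only [h, models_alls, forall_vec_two, Realize, realize_cellF, realize_headF,
    realize_headCompF]
  simp

theorem models_phi1M : Models A (phi1M M) ↔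
    (∃ x : A, UMin M x) ∧ (∃ x : A, UMax M x) ∧
    (∀ x y : A, Lt M x y → ∃ z, Succ M x z) ∧
    (∀ x t : A, Cell M false x t ∨ Cell M true x t) ∧
    ∀ (q : Fin M.numStates) (x t : A), Head M q x t ∨ HeadComp M q x t := by
  have h : ∀ F : Fin M.numStates → Sent (tau M),
      Models A (andStates M F) ↔ ∀ q, Models A (F q) := fun F => realize_andStates _ _
  have he : ∀ φ : Fml (tau M) 1, Models A (ex φ) ↔ ∃ a, φ.Realize A ![a] := fun φ => by
    simp only [Models, Realize, snoc_elim0]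
  simp only [phi1M, phi1, models_bigAnd, List.forall_mem_cons, h, he, models_alls,
    forall_vec_two, Realize, snoc_vec_two, realize_imp, realize_cellF, realize_headF,
    realize_headCompF, realize_uminF, realize_umaxF, realize_ltF, realize_succF]
  simp [and_assoc]

theorem models_gammaM : Models A (gammaM M) ↔
    ∃ t x : A, UMax M t ∧ Head M M.halt x t ∧
      ∀ t' y : A, Lt M t' t → ¬ Head M M.halt y t' := by
  simp only [Models, gammaM, Realize, snoc_elim0, snoc_vec_one, snoc_vec_two, snoc_vec_three,
    realize_bigAnd, List.forall_mem_cons, realize_imp, realize_umaxF, realize_headF, realize_ltF]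
  simp

variable (M) in
/-- The relation between the scanned cell `x` and the next scanned cell `x'` for a movement. -/
def Link : Move → A → A → Prop
  | .left, x, x' => Succ M x' x
  | .stay, x, x' => x' = x
  | .right, x, x' => Succ M x x'

variable (M) in
/-- What `afterStep` says. -/
def AfterStep (p : Fin M.numStates) (b : Bool) (x x' t t' y : A) : Prop :=
  ¬ Cell M (!b) x t' ∧ ¬ HeadComp M p x' t' ∧ (y ≠ x' → ∀ r, ¬ Head M r y t') ∧
    (y ≠ x → ∀ a, Cell M a y t → ¬ Cell M (!a) y t')

theorem realize_afterStep (p : Fin M.numStates) (b : Bool) (x x' t t' y : Fin n) :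
    (afterStep M p b x x' t t' y).Realize A v ↔
      AfterStep M p b (v x) (v x') (v t) (v t') (v y) := by
  simp only [afterStep, AfterStep, realize_bigAnd, List.forall_mem_cons, Realize, realize_imp,
    realize_cellF, realize_headF, realize_headCompF, realize_andStates, Bool.forall_bool]
  simp [and_assoc]

theorem models_instrF (q : Fin M.numStates) (a : Bool) (p : Fin M.numStates) (b : Bool)
    (d : Move) : Models A (instrF M q a p b d) ↔
      ∀ x x' t t' y : A, Head M q x t → Cell M a x t → Link M d x x' → Succ M t t' →
        AfterStep M p b x x' t t' y := by
  cases d <;>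
  simp only [instrF, models_alls, forall_vec_four, forall_vec_five, realize_imp, realize_bigAnd,
    List.forall_mem_cons, realize_headF, realize_cellF, realize_succF, realize_afterStep, Link]
  · simp
  · simp only [Matrix.cons_val, List.not_mem_nil, false_imp_iff, implies_true, and_true]
    constructor
    · rintro h x _ t t' y hq hc rfl hs
      exact h _ _ _ _ ⟨hq, hc, hs⟩
    · exact fun h x t t' y ⟨hq, hc, hs⟩ => h x x t t' y hq hc rfl hs
  · simp

theorem forall_mem_phi2List : (∀ φ ∈ phi2List M, Models A φ) ↔
    ∀ q a p b d, M.instr q a = some (p, b, d) → Models A (instrF M q a p b d) := by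
  simp only [phi2List, List.mem_flatMap, List.mem_finRange]
  refine ⟨fun h q a p b d hi => h _ ⟨q, trivial, a, by cases a <;> simp, by simp [hi]⟩, ?_⟩
  rintro h φ ⟨q, -, a, -, hφ⟩
  split at hφ
  · simp at hφ
  · next p b d hi =>
    rw [List.mem_singleton] at hφ
    exact hφ ▸ h _ _ _ _ _ hi

theorem realize_initialChain (k : ℕ) (h : k < n) :
    (initialChain M k h).Realize A v ↔ UMin M (v ⟨0, by omega⟩) ∧
      ∀ i (hi : i < k), Succ M (v ⟨i, by omega⟩) (v ⟨i + 1, by omega⟩) := by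
  simp only [initialChain, realize_bigAnd, realize_uminF, List.forall_mem_map, List.mem_finRange,
    true_imp_iff, realize_succF, Fin.forall_iff]

theorem models_initialHead : Models A (initialHead M) ↔
    ∀ x y : A, UMin M x → ¬ HeadComp M M.start x x ∧ (y ≠ x → ∀ q, ¬ Head M q y x) := by
  simp only [initialHead, models_alls, forall_vec_two, realize_imp, Realize, realize_uminF,
    realize_headCompF, realize_headF, realize_andStates]
  simp

theorem models_chi (w : List Bool) : Models A (chi M w) ↔
    Models A (phi0w M w) ∧ (Models A (phi1M M) → ¬ Models A (gammaM M)) :=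
  and_congr_right fun _ => realize_imp _ _ _

theorem models_phi0w (w : List Bool) : Models A (phi0w M w) ↔
    Models A (phi0 M) ∧ Models A (disjointSymbols M) ∧
    (∀ q a p b d, M.instr q a = some (p, b, d) → Models A (instrF M q a p b d)) ∧
    (∀ φ ∈ initialTapeList M w, Models A φ) ∧ Models A (initialHead M) := by
  simp only [phi0w, models_bigAnd, List.forall_mem_cons, List.forall_mem_append,
    forall_mem_phi2List]
  simp [and_assoc]

end Tau
end Gurevich

/-! ### Preservation under `<`-substructures -/

namespace Gurevich

open Fml

section Preservation

variable {M : Machine} (A : Type u) [(tau M).Structure A] (B : Set A) [(tau M).Structure B] {n : ℕ}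

/-- `φ` is preserved from `B` to `A`. -/
def Up (φ : Fml (tau M) n) : Prop :=
  ∀ v : Fin n → B, φ.Realize B v → φ.Realize A (fun i => (v i : A))

/-- `φ` is preserved from `A` to `B`. -/
def Down (φ : Fml (tau M) n) : Prop :=
  ∀ v : Fin n → B, φ.Realize A (fun i => (v i : A)) → φ.Realize B v

variable {A B}

theorem Up.not {φ : Fml (tau M) n} (h : Up A B φ) : Down A B (not φ) :=
  fun v hA hB => hA (h v hB)

theorem Down.not {φ : Fml (tau M) n} (h : Down A B φ) : Up A B (not φ) :=
  fun v hB hA => hB (h v hA)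

theorem Up.and {φ ψ : Fml (tau M) n} (h : Up A B φ) (h' : Up A B ψ) : Up A B (and φ ψ) :=
  fun v hB => ⟨h v hB.1, h' v hB.2⟩

theorem Up.bigAnd {φ : Fml (tau M) n} {l : List (Fml (tau M) n)} (h : Up A B φ)
    (hl : ∀ ψ ∈ l, Up A B ψ) : Up A B (bigAnd φ l) := fun v hB => by
  rw [realize_bigAnd] at hB ⊢
  exact ⟨h v hB.1, fun ψ hψ => hl ψ hψ v (hB.2 ψ hψ)⟩

theorem Down.or {φ ψ : Fml (tau M) n} (h : Down A B φ) (h' : Down A B ψ) : Down A B (or φ ψ) :=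
  fun v hA => Or.imp (h v) (h' v) hA

theorem Down.and {φ ψ : Fml (tau M) n} (h : Down A B φ) (h' : Down A B ψ) :
    Down A B (and φ ψ) :=
  fun v hA => And.imp (h v) (h' v) hA

theorem Down.bigAnd {φ : Fml (tau M) n} {l : List (Fml (tau M) n)} (h : Down A B φ)
    (hl : ∀ ψ ∈ l, Down A B ψ) : Down A B (bigAnd φ l) := fun v hA => by
  rw [realize_bigAnd] at hA ⊢
  exact ⟨h v hA.1, fun ψ hψ => hl ψ hψ v (hA.2 ψ hψ)⟩

theorem Up.imp {φ ψ : Fml (tau M) n} (h : Up A B φ) (h' : Down A B ψ) : Down A B (imp φ ψ) :=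
  h.not.or h'

theorem comp_coe_vec_two (x y : B) :
    (fun k => ((![x, y] k : B) : A)) = ![(x : A), (y : A)] := by
  funext k; fin_cases k <;> rfl

theorem coe_snoc (v : Fin n → B) (b : B) :
    (fun i => ((Fin.snoc v b : Fin (n + 1) → B) i : A)) =
      (Fin.snoc (fun i => (v i : A)) (b : A) : Fin (n + 1) → A) := by
  funext i
  refine Fin.lastCases ?_ (fun i => ?_) i <;> simp

theorem Down.alls : {n : ℕ} → {φ : Fml (tau M) n} → Down A B φ → Down A B (alls φ)
  | 0, _, h => h
  | _ + 1, φ, h => Down.alls (φ := all φ) fun v hA b => h _ (by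
      rw [coe_snoc]
      exact hA b)

theorem Down.andStates {F : Fin M.numStates → Fml (tau M) n} (h : ∀ q, Down A B (F q)) :
    Down A B (andStates M F) := fun v hA => by
  rw [realize_andStates] at hA ⊢
  exact fun q => h q v (hA q)

theorem Down.models {φ : Sent (tau M)} (h : Down A B φ) (hA : Models A φ) : Models B φ :=
  h _ (by rwa [Subsingleton.elim (fun i => ((Fin.elim0 i : B) : A)) Fin.elim0])

theorem down_eq (i j : Fin n) : Down A B (eq i j : Fml (tau M) n) := fun _ h => Subtype.ext h

theorem up_rel (hB : IsLtSubstructure M A B) {r : ℕ} (R : (tau M).Relations r) (t : Fin r → Fin n) :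
    Up A B (.rel R t) := fun _ h => hB.1 _ _ _ h

theorem up_cellF (hB : IsLtSubstructure M A B) (b : Bool) (i j : Fin n) :
    Up A B (cellF M b i j) := by
  cases b <;> exact up_rel hB _ _

theorem down_ltF (hB : IsLtSubstructure M A B) (i j : Fin n) : Down A B (ltF M i j) := fun v h => by
  rw [realize_ltF] at h ⊢
  refine (hB.2 _).2 ?_
  rwa [comp_coe_vec_two]

theorem down_phi0 (hB : IsLtSubstructure M A B) : Down A B (phi0 M) := by
  have hu : ∀ {n r : ℕ} (R : (tau M).Relations r) (t : Fin r → Fin n), Up A B (.rel R t) :=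
    up_rel hB
  refine Down.bigAnd (Up.not (hu _ _)).alls ?_
  simp only [List.forall_mem_cons]
  refine ⟨?_, ?_, ?_, ?_, ?_, ?_, by simp⟩
  · exact ((down_ltF hB _ _).or ((down_eq _ _).or (down_ltF hB _ _))).alls
  · exact (((hu _ _).and (hu _ _)).imp (down_ltF hB _ _)).alls
  · exact ((hu _ _).imp ((down_eq _ _).or (down_ltF hB _ _))).alls
  · exact ((hu _ _).imp ((down_eq _ _).or (down_ltF hB _ _))).alls
  · exact ((hu _ _).imp (down_ltF hB _ _)).alls
  · exact (((hu _ _).and (hu _ _)).imp (hu _ _).not).alls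

theorem down_afterStep (hB : IsLtSubstructure M A B) (p : Fin M.numStates) (b : Bool)
    (x x' t t' y : Fin n) :
    Down A B (afterStep M p b x x' t t' y) := by
  refine Down.bigAnd ((up_cellF hB _ _ _).not.and (up_rel hB _ _).not) ?_
  simp only [List.forall_mem_cons]
  refine ⟨?_, ?_, by simp⟩
  · exact (down_eq _ _).not.imp (Down.andStates fun r => (up_rel hB _ _).not)
  · exact (down_eq _ _).not.imp (((up_cellF hB _ _ _).imp (up_cellF hB _ _ _).not).and
      ((up_cellF hB _ _ _).imp (up_cellF hB _ _ _).not))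

theorem down_instrF (hB : IsLtSubstructure M A B) (q : Fin M.numStates) (a : Bool)
    (p : Fin M.numStates) (b : Bool) (d : Move) : Down A B (instrF M q a p b d) := by
  have hu : ∀ {n r : ℕ} (R : (tau M).Relations r) (t : Fin r → Fin n), Up A B (.rel R t) :=
    up_rel hB
  cases d <;> refine (Up.imp (Up.bigAnd (hu _ _) ?_) (down_afterStep hB _ _ _ _ _ _ _)).alls <;>
  simp only [List.forall_mem_cons]
  · exact ⟨up_cellF hB _ _ _, hu _ _, hu _ _, by simp⟩
  · exact ⟨up_cellF hB _ _ _, hu _ _, by simp⟩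
  · exact ⟨up_cellF hB _ _ _, hu _ _, hu _ _, by simp⟩

theorem up_initialChain (hB : IsLtSubstructure M A B) (k : ℕ) (h : k < n) :
    Up A B (initialChain M k h) :=
  Up.bigAnd (up_rel hB _ _) (List.forall_mem_map.2 fun _ _ => up_rel hB _ _)

theorem down_initialTapeList (hB : IsLtSubstructure M A B) (w : List Bool) :
    ∀ φ ∈ initialTapeList M w, Down A B φ := by
  have hc : ∀ {n : ℕ} (b : Bool) (i j : Fin n), Down A B (not (cellF M b i j)) :=
    fun b i j => (up_cellF hB b i j).not
  cases w with
  | nil =>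
    simp only [initialTapeList, List.forall_mem_cons]
    exact ⟨((up_rel hB _ _).imp (hc _ _ _)).alls, by simp⟩
  | cons a v =>
    simp only [initialTapeList, List.forall_mem_cons]
    refine ⟨((up_initialChain hB _ _).imp ((hc _ _ _).bigAnd ?_)).alls, ?_, by simp⟩
    · exact List.forall_mem_map.2 fun _ _ => hc _ _ _
    · exact (((up_initialChain hB _ _).and (up_rel hB _ _)).imp (hc _ _ _)).alls

/-- All relations except `<` occur only negatively in `φ_{0w}`. -/
theorem models_phi0w_of_isLtSubstructure (hB : IsLtSubstructure M A B) {w : List Bool}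
    (hA : Models A (phi0w M w)) : Models B (phi0w M w) := by
  rw [models_phi0w] at hA ⊢
  obtain ⟨h0, hd, hi, ht, hh⟩ := hA
  refine ⟨(down_phi0 hB).models h0, Down.models ?_ hd,
    fun q a p b d h => (down_instrF hB q a p b d).models (hi q a p b d h),
    fun φ hφ => (down_initialTapeList hB w φ hφ).models (ht φ hφ), Down.models ?_ hh⟩
  · exact Down.and ((up_cellF hB _ _ _).not.or (up_cellF hB _ _ _).not).alls
      (Down.andStates fun q => ((up_rel hB _ _).not.or (up_rel hB _ _).not).alls)
  · exact ((up_rel hB _ _).imp ((up_rel hB _ _).not.and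
      ((down_eq _ _).not.imp (Down.andStates fun q => (up_rel hB _ _).not)))).alls

end Preservation

/-! ### Infinite models of `φ_{0w} ∧ φ_{1M}` contain the computation on `w` -/

section Chain

variable {M : Machine} {A : Type u} [(tau M).Structure A]

/-- An infinite model has an unending `S`-chain from its minimum: the elements with
finitely many predecessors are not maximal, and their
immediate successors are of the same kind. -/
theorem exists_succ_chain [Infinite A] (h0 : Models A (phi0 M)) (h1 : Models A (phi1M M)) :
    ∃ e : ℕ → A, UMin M (e 0) ∧ ∀ i, Succ M (e i) (e (i + 1)) := by
  obtain ⟨-, htri, -, hmin, -, -, hS⟩ := models_phi0.1 h0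
  obtain ⟨⟨m, hm⟩, -, hsucc, -⟩ := models_phi1M.1 h1
  let I : Type u := {a : A // {x | ¬ Lt M a x}.Finite}
  have hI : ∀ a : I, ∃ z : I, Succ M a.1 z.1 := by
    rintro ⟨a, ha⟩
    obtain ⟨y, hy⟩ : ∃ y, Lt M a y := by
      by_contra! h
      exact Set.infinite_univ (ha.subset fun x _ => h x)
    obtain ⟨z, hz⟩ := hsucc a y hy
    refine ⟨⟨z, (ha.insert z).subset fun x hx => ?_⟩, hz⟩
    rcases htri z x with h | rfl | h
    · exact absurd h hx
    · exact .inl rfl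
    · exact .inr fun h' => hS a x z ⟨h', h⟩ hz
  choose g hg using hI
  have hm' : {x | ¬ Lt M m x}.Finite := by
    refine (Set.finite_singleton m).subset fun x hx => ?_
    rcases hmin m x hm with h | h
    · exact h.symm
    · exact absurd h hx
  refine ⟨fun i => (g^[i] ⟨m, hm'⟩).1, hm, fun i => ?_⟩
  simp only [Function.iterate_succ_apply']
  exact hg _

theorem lt_of_chain (h0 : Models A (phi0 M)) {e : ℕ → A} (he : ∀ i, Succ M (e i) (e (i + 1)))
    {i j : ℕ} (hij : i < j) : Lt M (e i) (e j) := by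
  obtain ⟨-, -, htrans, -, -, hS, -⟩ := models_phi0.1 h0
  induction j, hij using Nat.le_induction with
  | base => exact hS _ _ (he i)
  | succ j _ ih => exact htrans _ _ _ ⟨ih, hS _ _ (he j)⟩

theorem initial_tape_of_chain {w : List Bool} (h : Models A (phi0w M w)) {e : ℕ → A}
    (he0 : UMin M (e 0)) (he : ∀ i, Succ M (e i) (e (i + 1))) (i : ℕ) :
    ¬ Cell M (!(w.getD i false)) (e i) (e 0) := by
  obtain ⟨h0, -, -, ht, -⟩ := (models_phi0w w).1 h
  cases w with
  | nil =>
    simp only [initialTapeList, List.forall_mem_cons, models_alls, forall_vec_two, realize_imp,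
      realize_uminF, Realize, realize_cellF] at ht
    exact ht.1 (e 0) (e i) he0
  | cons a v =>
    simp only [initialTapeList, List.forall_mem_cons, models_alls, realize_imp,
      realize_initialChain, realize_bigAnd, Realize, realize_cellF, realize_ltF,
      List.forall_mem_map] at ht
    obtain ⟨h1, h2, -⟩ := ht
    rcases i with _ | i
    · exact (h1 (fun j => e j) ⟨he0, fun j _ => he j⟩).1
    · by_cases hi : i < v.length
      · have := (h1 (fun j => e j) ⟨he0, fun j _ => he j⟩).2 ⟨i, hi⟩ (List.mem_finRange _)
        simpa [List.getD_eq_getElem?_getD, hi] using this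
      · -- the chain occupies the variables `0, …, |v|`; the last variable stands for cell `i + 1`
        have := h2 (fun j => if (j : ℕ) ≤ v.length then e j else e (i + 1))
          ⟨⟨by simpa using he0, fun j hj => ?_⟩, ?_⟩
        · simpa [List.getD_eq_getElem?_getD, hi] using this
        · have h3 : j ≤ v.length := by omega
          have h4 : j + 1 ≤ v.length := by omega
          simpa [h3, h4] using he j
        · simpa using lt_of_chain h0 he (show v.length < i + 1 by omega)

theorem cell_of_not_cell (h1 : Models A (phi1M M)) {b : Bool} {x t : A}
    (h : ¬ Cell M (!b) x t) : Cell M b x t := by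
  have := (models_phi1M.1 h1).2.2.2.1 x t
  cases b
  · exact this.resolve_right h
  · exact this.resolve_left h

theorem head_of_not_headComp (h1 : Models A (phi1M M)) {q : Fin M.numStates} {x t : A}
    (h : ¬ HeadComp M q x t) : Head M q x t :=
  ((models_phi1M.1 h1).2.2.2.2 q x t).resolve_right h

theorem link_of_moveHead {e : ℕ → A} (he : ∀ i, Succ M (e i) (e (i + 1))) {d : Move} {i j : ℕ}
    (h : Machine.moveHead d i = some j) : Link M d (e i) (e j) := by
  cases d
  · cases i with
    | zero => cases h
    | succ i =>
      cases h
      exact he _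
  · cases h
    rfl
  · cases h
    exact he _

/-- Along an endless `S`-chain from the minimum the structure is forced to
record the computation. Only the cells and times on the chain are controlled; this suffices, as the
head never leaves the chain. -/
theorem chain_follows_run {w : List Bool} (h : Models A (phi0w M w))
    (h1 : Models A (phi1M M)) {e : ℕ → A} (he0 : UMin M (e 0))
    (he : ∀ i, Succ M (e i) (e (i + 1))) (t : ℕ) (c : M.Config) (hc : M.run w t = some c) :
    Head M c.state (e c.head) (e t) ∧ ∀ i, Cell M (c.tape i) (e i) (e t) := by
  obtain ⟨h0, -, hinstr, -, hhead⟩ := (models_phi0w w).1 h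
  induction t generalizing c with
  | zero =>
    cases hc
    exact ⟨head_of_not_headComp h1 (models_initialHead.1 hhead _ (e 0) he0).1,
      fun i => cell_of_not_cell h1 (initial_tape_of_chain h he0 he i)⟩
  | succ t ih =>
    obtain ⟨c₀, hc₀, hstep⟩ := Option.bind_eq_some_iff.1 hc
    obtain ⟨ihh, iht⟩ := ih c₀ hc₀
    unfold Machine.step at hstep
    split at hstep
    · cases hstep
    obtain ⟨⟨p, b, d⟩, hi, hstep⟩ := Option.bind_eq_some_iff.1 hstep
    obtain ⟨j, hj, rfl⟩ := Option.map_eq_some_iff.1 hstep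
    have key := fun y => (models_instrF _ _ _ _ _).1 (hinstr _ _ _ _ _ hi) (e c₀.head) (e j) (e t)
      (e (t + 1)) y ihh (iht _) (link_of_moveHead he hj) (he t)
    refine ⟨head_of_not_headComp h1 (key (e 0)).2.1, fun i => cell_of_not_cell h1 ?_⟩
    rcases eq_or_ne i c₀.head with rfl | hne
    · simpa using (key (e 0)).1
    · have hne' : e i ≠ e c₀.head := fun heq => by
        have hirr := (models_phi0.1 h0).1
        rcases hne.lt_or_gt with hlt | hlt
        · exact hirr _ (heq ▸ lt_of_chain h0 he hlt)
        · exact hirr _ (heq ▸ lt_of_chain h0 he hlt)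
      simpa [Function.update_of_ne hne] using (key (e i)).2.2.2 hne' _ (iht i)

/-- If `M` halts on `w`, then in an infinite model the halting state is reached before the
last element. -/
theorem finite_of_models_gammaM {w : List Bool} {t : ℕ} (ht : M.HaltsIn w t)
    (h : Models A (phi0w M w)) (h1 : Models A (phi1M M)) (hg : Models A (gammaM M)) :
    Finite A := by
  by_contra hfin
  have : Infinite A := not_finite_iff_infinite.1 hfin
  have h0 := ((models_phi0w w).1 h).1
  obtain ⟨e, he0, he⟩ := exists_succ_chain h0 h1
  obtain ⟨c, hc, hq⟩ := ht
  obtain ⟨m, -, hm, -, hearly⟩ := models_gammaM.1 hg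
  have hhead := (chain_follows_run h h1 he0 he t c hc).1
  rw [hq] at hhead
  obtain ⟨hirr, -, htrans, -, hmax, -, -⟩ := models_phi0.1 h0
  refine hearly _ _ ?_ hhead
  have hlt := lt_of_chain h0 he t.lt_succ_self
  rcases hmax m (e (t + 1)) hm with rfl | h'
  · exact hlt
  · exact htrans _ _ _ ⟨hlt, h'⟩

end Chain

/-! ### Closure under `<`-substructures -/

section Closure

variable {M : Machine} {A : Type u} [(tau M).Structure A] {B : Set A} [(tau M).Structure B]

theorem coe_vec_one (x : B) : (fun k => ((![x] k : B) : A)) = ![(x : A)] := by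
  funext k; fin_cases k; rfl

theorem IsLtSubstructure.lt_iff (hB : IsLtSubstructure M A B) {x y : B} :
    Lt M x y ↔ Lt M (x : A) y := by
  rw [Lt, hB.2, Lt, comp_coe_vec_two]

theorem IsLtSubstructure.uMin (hB : IsLtSubstructure M A B) {x : B} (h : UMin M x) :
    UMin M (x : A) := by
  have := hB.1 _ _ _ h
  rwa [coe_vec_one] at this

theorem IsLtSubstructure.uMax (hB : IsLtSubstructure M A B) {x : B} (h : UMax M x) :
    UMax M (x : A) := by
  have := hB.1 _ _ _ h
  rwa [coe_vec_one] at this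

theorem IsLtSubstructure.succ (hB : IsLtSubstructure M A B) {x y : B} (h : Succ M x y) :
    Succ M (x : A) y := by
  have := hB.1 _ _ _ h
  rwa [comp_coe_vec_two] at this

theorem IsLtSubstructure.head (hB : IsLtSubstructure M A B) {q : Fin M.numStates} {x y : B}
    (h : Head M q x y) : Head M q (x : A) y := by
  have := hB.1 _ _ _ h
  rwa [comp_coe_vec_two] at this

theorem IsLtSubstructure.headComp (hB : IsLtSubstructure M A B) {q : Fin M.numStates} {x y : B}
    (h : HeadComp M q x y) : HeadComp M q (x : A) y := by
  have := hB.1 _ _ _ h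
  rwa [comp_coe_vec_two] at this

theorem IsLtSubstructure.cell (hB : IsLtSubstructure M A B) {b : Bool} {x y : B}
    (h : Cell M b x y) : Cell M b (x : A) y := by
  cases b <;>
  · have := hB.1 _ _ _ h
    rwa [comp_coe_vec_two] at this

/-- A finite `<`-substructure that satisfies `φ_{1M}` contains every element: between the largest
element of `B` below `a` and its `S`-successor in `B` there is no room for `a`. -/
theorem mem_of_models_phi1M [Finite B] (hB : IsLtSubstructure M A B) (h0 : Models A (phi0 M))
    (h1 : Models B (phi1M M)) (a : A) : a ∈ B := by
  by_contra ha
  obtain ⟨hirr, htri, htrans, hmin, hmax, -, hS⟩ := models_phi0.1 h0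
  obtain ⟨⟨m, hm⟩, ⟨n, hn⟩, hsucc, -⟩ := models_phi1M.1 h1
  have hne : ∀ b : B, (b : A) ≠ a := fun b h => ha (h ▸ b.2)
  have hma : Lt M (m : A) a := (hmin _ a (hB.uMin hm)).resolve_left (hne m)
  have han : Lt M a (n : A) := (hmax _ a (hB.uMax hn)).resolve_left (hne n)
  have : IsTrans B (fun x y => Lt M (y : A) (x : A)) :=
    ⟨fun x y z h h' => htrans _ _ _ ⟨h', h⟩⟩
  have : Std.Irrefl (fun x y : B => Lt M (y : A) (x : A)) := ⟨fun x => hirr x⟩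
  have hwf : WellFounded (fun x y : B => Lt M (y : A) (x : A)) :=
    Finite.wellFounded_of_trans_of_irrefl _
  obtain ⟨b, hb, hbmax⟩ := hwf.has_min {b : B | Lt M (b : A) a} ⟨m, hma⟩
  obtain ⟨z, hz⟩ := hsucc b n (hB.lt_iff.2 (htrans _ _ _ ⟨hb, han⟩))
  have hbz := (models_phi0.1 h0).2.2.2.2.2.1 _ _ (hB.succ hz)
  rcases htri (z : A) a with h | h | h
  · exact hbmax z h hbz
  · exact hne z h
  · exact hS _ _ _ ⟨hb, h⟩ (hB.succ hz)

theorem closedUnderLtSubstructures_chi {w : List Bool} {t : ℕ} (ht : M.HaltsIn w t) :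
    ClosedUnderLtSubstructures.{u} (chi M w) := by
  intro A _ _ B _ _ hB hA
  rw [models_chi] at hA ⊢
  have hB0 := models_phi0w_of_isLtSubstructure hB hA.1
  refine ⟨hB0, fun h1 hg => ?_⟩
  have : Finite B := finite_of_models_gammaM ht hB0 h1 hg
  have h0 := ((models_phi0w w).1 hA.1).1
  have hmem := mem_of_models_phi1M hB h0 h1
  have hdisj := (models_disjointSymbols.1 ((models_phi0w w).1 hA.1).2.1).2
  obtain ⟨⟨m, hm⟩, ⟨n, hn⟩, hsucc, hcell, hhead⟩ := models_phi1M.1 h1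
  obtain ⟨t, x, ht, hx, hearly⟩ := models_gammaM.1 hg
  refine hA.2 (models_phi1M.2 ⟨⟨m, hB.uMin hm⟩, ⟨n, hB.uMax hn⟩, fun x y h => ?_, fun x t => ?_,
    fun q x t => ?_⟩) (models_gammaM.2 ⟨t, x, hB.uMax ht, hB.head hx, fun t' y h hy => ?_⟩)
  · obtain ⟨z, hz⟩ := hsucc ⟨x, hmem x⟩ ⟨y, hmem y⟩ (hB.lt_iff.2 h)
    exact ⟨z, hB.succ hz⟩
  · exact (hcell ⟨x, hmem x⟩ ⟨t, hmem t⟩).imp hB.cell hB.cell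
  · exact (hhead q ⟨x, hmem x⟩ ⟨t, hmem t⟩).imp hB.head hB.headComp
  · -- as `H_{q_h}` and its complement are disjoint in `A` and exhaustive in `B`, they agree
    rcases hhead M.halt ⟨y, hmem y⟩ ⟨t', hmem t'⟩ with h' | h'
    · exact hearly ⟨t', hmem t'⟩ ⟨y, hmem y⟩ (hB.lt_iff.2 h) h'
    · exact (hdisj M.halt y t').elim (· hy) (· (hB.headComp h'))

end Closure

end Gurevich

/-! ### The structure that records a halting computation -/

namespace Gurevich

open Fml

section RunModel

variable (M : Machine)

/-- The universe `{0, …, h}` of the structure that records the configurations `c 0, …, c h`. -/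
def RunModel (_ : ℕ → M.Config) (h : ℕ) : Type u := ULift.{u} (Fin (h + 1))

variable {M} (c : ℕ → M.Config) (h : ℕ)

namespace RunModel

instance : Finite (RunModel.{u} M c h) := inferInstanceAs (Finite (ULift (Fin (h + 1))))

variable {c h}

/-- The number of an element of the universe. -/
def idx (x : RunModel.{u} M c h) : ℕ := (ULift.down x : Fin (h + 1)).val

variable (c) in
/-- The element with a given number. -/
def ofNat (i : ℕ) (hi : i ≤ h) : RunModel.{u} M c h := ULift.up ⟨i, Nat.lt_succ_of_le hi⟩

@[simp] theorem idx_ofNat (i : ℕ) (hi : i ≤ h) : (ofNat c i hi : RunModel.{u} M c h).idx = i := rfl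

theorem idx_le (x : RunModel.{u} M c h) : x.idx ≤ h := Nat.le_of_lt_succ (ULift.down x : Fin _).2

theorem idx_inj {x y : RunModel.{u} M c h} : x.idx = y.idx ↔ x = y :=
  ⟨fun e => ULift.ext _ _ (Fin.ext e), fun e => e ▸ rfl⟩

/-- Order, first and last element and successor are the usual ones; the other relations record
state, head position and tape contents at time `t` as given by `c t`. -/
instance : (tau M).Structure (RunModel.{u} M c h) where
  funMap f := nomatch f
  RelMap {_} R := match R with
    | .lt => fun v => (v 0).idx < (v 1).idx
    | .umin => fun v => (v 0).idx = 0
    | .umax => fun v => (v 0).idx = h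
    | .succ => fun v => (v 0).idx + 1 = (v 1).idx
    | .head q => fun v => (c (v 1).idx).state = q ∧ (c (v 1).idx).head = (v 0).idx
    | .headComp q => fun v => ¬ ((c (v 1).idx).state = q ∧ (c (v 1).idx).head = (v 0).idx)
    | .zero => fun v => (c (v 1).idx).tape (v 0).idx = false
    | .zeroComp => fun v => (c (v 1).idx).tape (v 0).idx = true

variable {x y t : RunModel.{u} M c h}

theorem lt_iff : Lt M x y ↔ x.idx < y.idx := Iff.rfl

theorem uMin_iff : UMin M x ↔ x.idx = 0 := Iff.rfl

theorem uMax_iff : UMax M x ↔ x.idx = h := Iff.rfl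

theorem succ_iff : Succ M x y ↔ x.idx + 1 = y.idx := Iff.rfl

theorem head_iff {q : Fin M.numStates} :
    Head M q x t ↔ (c t.idx).state = q ∧ (c t.idx).head = x.idx := Iff.rfl

theorem headComp_iff {q : Fin M.numStates} : HeadComp M q x t ↔ ¬ Head M q x t := Iff.rfl

theorem cell_iff {b : Bool} : Cell M b x t ↔ (c t.idx).tape x.idx = b := by
  cases b <;> rfl

theorem models_phi0 : Models (RunModel.{u} M c h) (phi0 M) := by
  rw [Gurevich.models_phi0]
  simp only [lt_iff, uMin_iff, uMax_iff, succ_iff, ← idx_inj]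
  refine ⟨fun x => lt_irrefl _, fun x y => lt_trichotomy _ _, ?_, ?_, ?_, ?_, ?_⟩
  · intros; omega
  · intros; omega
  · intro x y _
    have := y.idx_le
    omega
  · intros; omega
  · intros; omega

theorem models_disjointSymbols : Models (RunModel.{u} M c h) (disjointSymbols M) := by
  rw [Gurevich.models_disjointSymbols]
  simp only [cell_iff, headComp_iff]
  refine ⟨fun x t => ?_, fun q x t => ?_⟩
  · cases (c t.idx).tape x.idx <;> simp
  · tauto

theorem models_phi1M : Models (RunModel.{u} M c h) (phi1M M) := by
  rw [Gurevich.models_phi1M]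
  refine ⟨⟨ofNat c 0 (Nat.zero_le _), rfl⟩, ⟨ofNat c h le_rfl, rfl⟩, fun x y hxy => ?_,
    fun x t => ?_, fun q x t => ?_⟩
  · rw [lt_iff] at hxy
    exact ⟨ofNat c (x.idx + 1) (by have := y.idx_le; omega), rfl⟩
  · simp only [cell_iff]
    cases (c t.idx).tape x.idx <;> simp
  · exact Classical.em _

theorem models_instrF (hc : ∀ t < h, M.step (c t) = some (c (t + 1)))
    {q : Fin M.numStates} {a : Bool} {p : Fin M.numStates} {b : Bool} {d : Move}
    (hi : M.instr q a = some (p, b, d)) :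
    Models (RunModel.{u} M c h) (instrF M q a p b d) := by
  rw [Gurevich.models_instrF]
  intro x x' t t' y hq ha hl ht
  rw [head_iff] at hq
  rw [cell_iff] at ha
  rw [succ_iff] at ht
  obtain ⟨hq, hx⟩ := hq
  have hstep := hc t.idx (by have := t'.idx_le; omega)
  have hmove : Machine.moveHead d x.idx = some x'.idx := by
    cases d
    · rw [← show x'.idx + 1 = x.idx from hl]; rfl
    · rw [show x' = x from hl]; rfl
    · rw [← show x.idx + 1 = x'.idx from hl]; rfl
  unfold Machine.step at hstep
  split at hstep
  · cases hstep
  rw [hx, hq, ha, hi, Option.bind_some, hmove, Option.map_some, Option.some_inj, ht] at hstep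
  simp only [AfterStep, cell_iff, headComp_iff, head_iff, ← hstep, Function.update_self]
  refine ⟨by simp, by simp, fun hy r h => hy (idx_inj.1 h.2.symm), fun hy a h => ?_⟩
  rw [Function.update_of_ne (mt idx_inj.1 hy), h]
  simp

theorem models_initialTapeList {w : List Bool} (h0 : c 0 = M.init w) :
    ∀ φ ∈ initialTapeList M w, Models (RunModel.{u} M c h) φ := by
  have htape : ∀ i, (c 0).tape i = w.getD i false := fun i => by rw [h0]; rfl
  cases w with
  | nil =>
    simp only [initialTapeList, List.forall_mem_cons, models_alls, forall_vec_two, realize_imp,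
      realize_uminF, Realize, realize_cellF, uMin_iff, cell_iff]
    refine ⟨fun x y hx => ?_, by simp⟩
    simp only [Matrix.cons_val] at hx ⊢
    rw [hx, htape]
    simp
  | cons a v =>
    simp only [initialTapeList, List.forall_mem_cons, models_alls, realize_imp,
      realize_initialChain, realize_bigAnd, Realize, realize_cellF, realize_ltF,
      List.forall_mem_map, uMin_iff, succ_iff, cell_iff, lt_iff]
    -- the elements of an initial chain are the first ones
    have hchain : ∀ {n k : ℕ} (hk : k < n) (u : Fin n → RunModel.{u} M c h),
        ((u ⟨0, by omega⟩).idx = 0 ∧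
          ∀ i (hi : i < k), (u ⟨i, by omega⟩).idx + 1 = (u ⟨i + 1, by omega⟩).idx) →
        ∀ i (hi : i ≤ k), (u ⟨i, by omega⟩).idx = i := by
      intro n k hk u hu i hi
      induction i with
      | zero => exact hu.1
      | succ i ih => rw [← hu.2 i (by omega), ih (by omega)]
    refine ⟨fun u hu => ?_, fun u hu => ?_, by simp⟩
    · have hidx := hchain (Nat.lt_succ_self _) u hu
      have hz : (u 0).idx = 0 := hu.1
      rw [hz, htape]
      refine ⟨by simp, fun i _ => ?_⟩
      rw [show (u i.succ).idx = i + 1 from hidx (i + 1) (by omega), htape]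
      simp [List.getD_eq_getElem?_getD]
    · have hlast := hchain (by omega) u hu.1 v.length le_rfl
      have hz : (u 0).idx = 0 := hu.1.1
      have hlt := hu.2
      rw [show (u (Fin.last v.length).castSucc).idx = v.length from hlast] at hlt
      rw [hz, htape]
      simp [List.getD_eq_getElem?_getD, List.getElem?_eq_none (show (a :: v).length ≤ _ from hlt)]

theorem models_initialHead {w : List Bool} (h0 : c 0 = M.init w) :
    Models (RunModel.{u} M c h) (initialHead M) := by
  rw [Gurevich.models_initialHead]
  intro x y hx
  rw [uMin_iff] at hx
  simp only [headComp_iff, head_iff, hx, h0]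
  exact ⟨fun h => h ⟨rfl, rfl⟩, fun hy q h => hy (idx_inj.1 (h.2.symm.trans hx.symm))⟩

theorem models_phi0w {w : List Bool} (h0 : c 0 = M.init w)
    (hc : ∀ t < h, M.step (c t) = some (c (t + 1))) :
    Models (RunModel.{u} M c h) (phi0w M w) :=
  (Gurevich.models_phi0w w).2 ⟨models_phi0, models_disjointSymbols,
    fun _ _ _ _ _ hi => models_instrF hc hi, models_initialTapeList h0, models_initialHead h0⟩

theorem models_gammaM (hhead : (c h).head ≤ h) (hhalt : (c h).state = M.halt)
    (hne : ∀ t < h, (c t).state ≠ M.halt) :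
    Models (RunModel.{u} M c h) (gammaM M) :=
  Gurevich.models_gammaM.2 ⟨ofNat c h le_rfl, ofNat c (c h).head hhead, rfl, ⟨hhalt, rfl⟩,
    fun t _ ht hq => hne t.idx ht hq.1⟩

end RunModel

/-! ### Induced substructures -/

variable (M) in
/-- The substructure of `A` induced on the set `B`. -/
@[reducible] def inducedStructure (A : Type u) [(tau M).Structure A] (B : Set A) :
    (tau M).Structure B where
  funMap f := nomatch f
  RelMap R v := FirstOrder.Language.Structure.RelMap R fun i => (v i : A)

/-- If a universal formula fails in `A`, this is witnessed by few elements: it fails in every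
induced substructure that contains them. -/
theorem Fml.IsUniversal.exists_witnesses {A : Type u} [(tau M).Structure A] {n : ℕ}
    {φ : Fml (tau M) n} (hφ : φ.IsUniversal) (v : Fin n → A) (hv : ¬ φ.Realize A v) :
    ∃ s : Finset A, s.card ≤ φ.length ∧ ∀ (B : Set A), (s : Set A) ⊆ B →
      ∀ v' : Fin n → B, (∀ i, (v' i : A) = v i) →
        ¬ @Fml.Realize (tau M) B (inducedStructure M A B) n φ v' := by
  classical
  induction hφ with
  | eq i j =>
    refine ⟨∅, by simp, fun B _ v' hv' h => hv ?_⟩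
    rw [Realize, ← hv', ← hv']
    exact congrArg Subtype.val h
  | not_eq i j =>
    refine ⟨∅, by simp, fun B _ v' hv' h => hv fun h' => h (Subtype.ext ?_)⟩
    rw [hv', hv']
    exact h'
  | rel R t =>
    refine ⟨∅, by simp, fun B _ v' hv' h => hv ?_⟩
    simp only [Realize, ← hv']
    exact h
  | not_rel R t =>
    refine ⟨∅, by simp, fun B _ v' hv' h => hv fun h' => h ?_⟩
    simp only [Realize, ← hv'] at h'
    exact h'
  | @and n φ ψ _ _ ih₁ ih₂ =>
    by_cases h₁ : φ.Realize A v
    · obtain ⟨s, hs, H⟩ := ih₂ v fun h₂ => hv ⟨h₁, h₂⟩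
      exact ⟨s, by simp only [length]; omega, fun B hB v' hv' h => H B hB v' hv' h.2⟩
    · obtain ⟨s, hs, H⟩ := ih₁ v h₁
      exact ⟨s, by simp only [length]; omega, fun B hB v' hv' h => H B hB v' hv' h.1⟩
  | @or n φ ψ _ _ ih₁ ih₂ =>
    obtain ⟨s, hs, H⟩ := ih₁ v fun h => hv (.inl h)
    obtain ⟨s', hs', H'⟩ := ih₂ v fun h => hv (.inr h)
    refine ⟨s ∪ s', ?_, fun B hB v' hv' h => ?_⟩
    · have := Finset.card_union_le s s'
      simp only [length]
      omega
    · rw [Finset.coe_union, Set.union_subset_iff] at hB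
      exact h.elim (H B hB.1 v' hv') (H' B hB.2 v' hv')
  | @all n φ _ ih =>
    obtain ⟨a, ha⟩ := not_forall.1 hv
    obtain ⟨s, hs, H⟩ := ih _ ha
    refine ⟨insert a s, ?_, fun B hB v' hv' h => ?_⟩
    · have := Finset.card_insert_le a s
      simp only [length]
      omega
    · rw [Finset.coe_insert, Set.insert_subset_iff] at hB
      refine H B hB.2 _ (fun i => ?_) (h ⟨a, hB.1⟩)
      refine Fin.lastCases ?_ (fun i => ?_) i <;> simp [hv']

theorem isLtSubstructure_induced (A : Type u) [(tau M).Structure A] (B : Set A) :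
    @IsLtSubstructure M A _ B (inducedStructure M A B) :=
  let _ := inducedStructure M A B
  ⟨fun _ _ _ h => h, fun _ => Iff.rfl⟩

/-- A finite structure that violates a universal sentence satisfied by all of its proper induced
substructures is not much larger than the sentence is long. -/
theorem card_le_length_of_isUniversal {A : Type u} [Nonempty A] [Finite A] [(tau M).Structure A]
    {μ : Sent (tau M)} (hμ : μ.IsUniversal) (hA : ¬ Models A μ)
    (hsub : ∀ B : Set A, B.Nonempty → B ≠ Set.univ →
      @Models (tau M) B (inducedStructure M A B) μ) :
    Nat.card A ≤ μ.length + 1 := by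
  classical
  by_contra! hcard
  obtain ⟨s, hs, H⟩ := hμ.exists_witnesses _ hA
  obtain ⟨a⟩ := ‹Nonempty A›
  refine H (insert a s : Finset A) (by simp) Fin.elim0 (fun i => i.elim0) (hsub _ ⟨a, by simp⟩ ?_)
  intro huniv
  have h1 : Nat.card A = (insert a s).card := by
    rw [← Set.ncard_univ, ← huniv, Set.ncard_coe_finset]
  have h2 := Finset.card_insert_le a s
  omega

end RunModel

/-! ### The lower bound -/

section LowerBound

variable {M : Machine} {w : List Bool}

theorem Machine.run_eq_some_of_le {t h : ℕ} (hth : t ≤ h) {c : M.Config}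
    (hc : M.run w h = some c) : ∃ c', M.run w t = some c' := by
  induction h, hth using Nat.le_induction generalizing c with
  | base => exact ⟨c, hc⟩
  | succ h _ ih =>
    obtain ⟨c₀, hc₀, -⟩ := Option.bind_eq_some_iff.1 hc
    exact ih hc₀

theorem Machine.head_le_of_run {t : ℕ} {c : M.Config} (hc : M.run w t = some c) :
    c.head ≤ t := by
  induction t generalizing c with
  | zero => cases hc; exact le_rfl
  | succ t ih =>
    obtain ⟨c₀, hc₀, hstep⟩ := Option.bind_eq_some_iff.1 hc
    have hle := ih hc₀
    unfold Machine.step at hstep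
    split at hstep
    · cases hstep
    obtain ⟨⟨p, b, d⟩, -, hstep⟩ := Option.bind_eq_some_iff.1 hstep
    obtain ⟨j, hj, rfl⟩ := Option.map_eq_some_iff.1 hstep
    change j ≤ t + 1
    change Machine.moveHead d c₀.head = some j at hj
    generalize c₀.head = i at hj hle
    cases d
    · cases i <;> cases hj
      omega
    · cases hj
      omega
    · cases hj
      omega

/-- The structure recording a halting computation of `h` steps violates `χ_w`, but its proper
induced substructures, not satisfying `φ_{1M}`, are models of `χ_w`. -/
theorem le_length_of_finitelyEquivalent {h : ℕ} (hw : M.HaltsIn w h) {μ : Sent (tau M)}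
    (hμ : μ.IsUniversal) (heq : FinitelyEquivalent.{u} (chi M w) μ) : h ≤ μ.length := by
  obtain ⟨ch, hrun, hhalt⟩ := hw
  let c : ℕ → M.Config := fun t => (M.run w t).getD (M.init w)
  have hc : ∀ t ≤ h, M.run w t = some (c t) := fun t ht => by
    obtain ⟨c', hc'⟩ := Machine.run_eq_some_of_le ht hrun
    simp [c, hc']
  have hch : c h = ch := by simp [c, hrun]
  have hstep : ∀ t < h, M.step (c t) = some (c (t + 1)) := fun t ht => by
    rw [← hc (t + 1) ht, Machine.run, hc t ht.le]
    rfl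
  have hne : ∀ t < h, (c t).state ≠ M.halt := fun t ht hq => by
    have := hstep t ht
    rw [Machine.step, if_pos hq] at this
    cases this
  have : Nonempty (RunModel.{u} M c h) := ⟨RunModel.ofNat c 0 (Nat.zero_le _)⟩
  have h0 : Models (RunModel.{u} M c h) (phi0w M w) := RunModel.models_phi0w rfl hstep
  have hA : ¬ Models (RunModel.{u} M c h) (chi M w) := fun hA =>
    ((models_chi w).1 hA).2 RunModel.models_phi1M
      (RunModel.models_gammaM (Machine.head_le_of_run (hc h le_rfl)) (hch ▸ hhalt) hne)
  have hcard : Nat.card (RunModel.{u} M c h) = h + 1 := by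
    change Nat.card (ULift.{u} (Fin (h + 1))) = h + 1
    simp
  have key := card_le_length_of_isUniversal hμ (mt (heq _).2 hA) fun B hB hne => ?_
  · omega
  let _ := inducedStructure M (RunModel.{u} M c h) B
  have : Nonempty B := hB.to_subtype
  have hsub := isLtSubstructure_induced (M := M) (RunModel.{u} M c h) B
  refine (heq B).1 ((models_chi w).2 ⟨models_phi0w_of_isLtSubstructure hsub h0, fun h1 _ => ?_⟩)
  exact hne (Set.eq_univ_of_forall
    (mem_of_models_phi1M hsub ((models_phi0w w).1 h0).1 h1))

end LowerBound

end Gurevich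

theorem mainTheorem7 (M : Gurevich.Machine) (hM : M.IsUniversal)
    (f : ℕ → ℕ) (hf : Computable f) :
    ∃ w : List Bool,
      Gurevich.ClosedUnderLtSubstructures.{u} (Gurevich.chi M w) ∧
      ∀ μ : Gurevich.Sent (Gurevich.tau M), μ.IsUniversal →
        Gurevich.FinitelyEquivalent.{u} (Gurevich.chi M w) μ →
        f (Gurevich.chi M w).length ≤ μ.length := by
  obtain ⟨w, h, hw, hlt⟩ := hM.exists_haltsIn_gt (hf.comp (Gurevich.computable_length_chi M))
  exact ⟨w, Gurevich.closedUnderLtSubstructures_chi hw, fun μ hμ heq =>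
    hlt.le.trans (Gurevich.le_length_of_finitelyEquivalent hw hμ heq)⟩
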